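/- **Theorem 7.8 (Roughgarden).** *Setting.* There are $m$ items and $k=k(m)$ players. For each $m$ fix a class $\mathcal V=\mathcal V_m$ of valuations, i.e. of monotone functions $v:2^{[m]}\to\mathbb R$ with $v(\emptyset)=0$, and numbers $W^*=W^*(m)>0$ and $\alpha=\alpha(m)>1$. An allocation gives every item to one player or to nobody; its welfare for $v_1,\dots,v_k\in\mathcal V$ is $\sum_i v_i(T_i)$, where $T_i$ is the bundle of player $i$. Consider the promise problem in which player $i$ knows only $v_i\in\mathcal V$: - (1-inputs) every allocation has welfare at most $W^*/\alpha$; - (0-inputs) some allocation has welfare at least $W^*$. A *nondeterministic protocol* of cost $c$ for its 1-inputs consists of predicates by which each player, seeing only its own valuation and a bit string of length at most $c$ published by a prover, accepts or rejects, such that for every 1-input some such string is accepted by all players, and for no 0-input is there such a string. "Subexponential" is read throughout as $2^{o(m)}$, or throughout as $2^{m^{o(1)}}$; the theorem holds under either reading. "Sub-doubly-exponential" means that the logarithm is subexponential. An *auction* gives each player a finite nonempty action set, and maps each action profile $a$ to a probability distribution over allocations (a point mass if the auction is deterministic) and to real payments $p_1(a),\dots,p_k(a)$; the utility of player $i$ is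 $u_i(a)=\mathbb E[v_i(T_i)]-p_i(a)$. An *$\varepsilon$-Nash equilibrium* is a profile of independent mixed strategies from which no player can increase its expected utility by more than $\varepsilon$ by switching to another mixed strategy. The *worst-case price of anarchy* $\mathrm{POA}_m$ of $\varepsilon$-Nash equilibria of an auction with $m$ items is the supremum, over all $v_1,\dots,v_k\in\mathcal V_m$ and all $\varepsilon$-Nash equilibria of the resulting game, of the maximum welfare of an allocation divided by the expected welfare of the equilibrium ($x/0=\infty$ for $x>0$, and $0/0=0$). *Theorem.* Suppose that $k(m)$ is at most subexponential in $m$ (for example constant or polynomial), and that there are no nondeterministic protocols for the 1-inputs of the promise problem, one for each $m$, whose cost is subexponential in $m$. Consider any auctions, one for each $m$, with a sub-doubly-exponential (in $m$) number of actions per player, whose utilities lie in $[-U(m),U(m)]$ for all valuations in $\mathcal V_m$ and all action profiles. Let $\varepsilon(m)>0$ be such that $U(m)\le P(k(m),m)\,\varepsilon(m)$ for some polynomial $P$ and all $m$; so, for utilities normalized to lie in $[-1,1]$, it suffices that $\varepsilon$ is bounded below by an inverse polynomial in $k$ and $m$. Then $$\limsup_{m\to\infty}\ \frac{\mathrm{POA}_m}{\alpha(m)}\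 \ge\ 1 .$$ In particular, if $\alpha$ is constant, then the worst-case price of anarchy of $\varepsilon$-Nash equilibria, $\sup_m \mathrm{POA}_m$, is at least $\alpha$. -/

import Mathlib

open Filter

noncomputable section

namespace AuctionPOA

/-! ## Growth rates -/

/-- The two usual meanings of the word "subexponential". -/
inductive ExpScale
  /-- `2 ^ o(m)` -/
  | linear
  /-- `2 ^ (m ^ o(1))` -/
  | power

/-- `f` grows subexponentially in `m`: for every `δ > 0` and all large `m`, it is at most
`2 ^ (δ m)` (linear scale), respectively at most `2 ^ (m ^ δ)` (power scale). -/
def Subexponential : ExpScale → (ℕ → ℝ) → Prop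
  | .linear, f => ∀ δ : ℝ, 0 < δ → ∀ᶠ m : ℕ in atTop, f m ≤ (2 : ℝ) ^ (δ * (m : ℝ))
  | .power, f => ∀ δ : ℝ, 0 < δ → ∀ᶠ m : ℕ in atTop, f m ≤ (2 : ℝ) ^ ((m : ℝ) ^ δ)

/-- `A` grows sub-doubly-exponentially in `m`: its logarithm is subexponential. -/
def SubDoublyExponential (s : ExpScale) (A : ℕ → ℕ) : Prop :=
  Subexponential s fun m => Real.logb 2 (A m)

/-! ## Nondeterministic number-in-hand protocols -/

/-- A `k`-party nondeterministic protocol in which every player holds a private input from `X`.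
The prover writes a bit string on the blackboard; `accept i x p` says that player `i`, who sees
only its own input `x` and the blackboard content `p`, accepts. The protocol accepts iff all
players do. -/
structure NondetProtocol (k : ℕ) (X : Type*) where
  accept : Fin k → X → List Bool → Prop

/-- With proofs of length at most `c`, the protocol verifies the `1`-inputs of the promise problem
with `1`-inputs `one` and `0`-inputs `zero`: every `1`-input has a proof that all players accept,
and no `0`-input has one. Nothing is asked on the remaining inputs. -/
def NondetProtocol.Verifies {k : ℕ} {X : Type*} (Q : NondetProtocol k X)
    (one zero : Set (Fin k → X)) (c : ℕ) : Prop :=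
  (∀ x ∈ one, ∃ p : List Bool, p.length ≤ c ∧ ∀ i, Q.accept i (x i) p) ∧
  (∀ x ∈ zero, ¬ ∃ p : List Bool, p.length ≤ c ∧ ∀ i, Q.accept i (x i) p)

/-! ## Valuations, allocations and welfare -/

/-- A (normalized, monotone) valuation of the bundles of `m` items. -/
structure Valuation (m : ℕ) where
  val : Finset (Fin m) → ℝ
  val_empty : val ∅ = 0
  mono : ∀ S T : Finset (Fin m), S ⊆ T → val S ≤ val T

/-- An allocation of `m` items to `k` players: each item goes to one player or to nobody.
(Valuations are monotone, so the maximum welfare is attained by a partition of all items among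
the players as soon as there is a player.) -/
abbrev Allocation (k m : ℕ) : Type := Fin m → Option (Fin k)

/-- The bundle that player `i` gets. -/
def Allocation.bundle {k m : ℕ} (T : Allocation k m) (i : Fin k) : Finset (Fin m) :=
  Finset.univ.filter fun j => T j = some i

def welfare {k m : ℕ} (v : Fin k → Valuation m) (T : Allocation k m) : ℝ :=
  ∑ i, (v i).val (T.bundle i)

/-- The maximum of the welfare over the (finitely many) allocations. -/
def maxWelfare {k m : ℕ} (v : Fin k → Valuation m) : ℝ :=
  ⨆ T : Allocation k m, welfare v T

/-- The `1`-inputs of the promise problem: every allocation has welfare at most `W / α`. -/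
def oneInputs {m : ℕ} (k : ℕ) (V : Set (Valuation m)) (W α : ℝ) : Set (Fin k → V) :=
  {x | ∀ T : Allocation k m, welfare (fun i => (x i : Valuation m)) T ≤ W / α}

/-- The `0`-inputs of the promise problem: some allocation has welfare at least `W`. -/
def zeroInputs {m : ℕ} (k : ℕ) (V : Set (Valuation m)) (W : ℝ) : Set (Fin k → V) :=
  {x | ∃ T : Allocation k m, W ≤ welfare (fun i => (x i : Valuation m)) T}

/-! ## Finite games and approximate Nash equilibria -/

/-- A finite normal-form game with `k` players. -/
structure Game (k : ℕ) where
  Action : Fin k → Type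
  [fintypeAction : ∀ i, Fintype (Action i)]
  [nonemptyAction : ∀ i, Nonempty (Action i)]
  utility : (∀ i, Action i) → Fin k → ℝ

attribute [instance] Game.fintypeAction Game.nonemptyAction

/-- The expectation of `f` when the players draw their actions independently from `σ`. -/
def mixedExpectation {k : ℕ} {Act : Fin k → Type} [∀ i, Fintype (Act i)]
    (σ : ∀ i, stdSimplex ℝ (Act i)) (f : (∀ i, Act i) → ℝ) : ℝ :=
  ∑ a : ∀ i, Act i, (∏ i, (σ i : Act i → ℝ) (a i)) * f a

/-- `σ` is an `ε`-Nash equilibrium: no player can increase its expected utility by more than `ε`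
by switching to a different mixed strategy. -/
def Game.IsEpsNash {k : ℕ} (G : Game k) (ε : ℝ) (σ : ∀ i, stdSimplex ℝ (G.Action i)) : Prop :=
  ∀ (i : Fin k) (τ : stdSimplex ℝ (G.Action i)),
    mixedExpectation (Function.update σ i τ) (fun a => G.utility a i) ≤
      mixedExpectation σ (fun a => G.utility a i) + ε

/-! ## Auctions and the price of anarchy -/

/-- An auction of `m` items to `k` players. It does not know the valuations: the players choose
actions, and the action profile determines a lottery over allocations (a point mass, if the auction
is deterministic) and the (expected) payment of each player. -/
structure Auction (k m : ℕ) where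
  Action : Fin k → Type
  [fintypeAction : ∀ i, Fintype (Action i)]
  [nonemptyAction : ∀ i, Nonempty (Action i)]
  lottery : (∀ i, Action i) → stdSimplex ℝ (Allocation k m)
  payment : (∀ i, Action i) → Fin k → ℝ

attribute [instance] Auction.fintypeAction Auction.nonemptyAction

namespace Auction

variable {k m : ℕ}

/-- The expected value of `g` at the allocation chosen by the auction for the profile `a`. -/
def lotteryExpectation (M : Auction k m) (a : ∀ i, M.Action i) (g : Allocation k m → ℝ) : ℝ :=
  ∑ T : Allocation k m, (M.lottery a : Allocation k m → ℝ) T * g T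

/-- The game that the players face: utility is the value of the items won minus the payment. -/
def game (M : Auction k m) (v : Fin k → Valuation m) : Game k where
  Action := M.Action
  utility a i := M.lotteryExpectation a (fun T => (v i).val (T.bundle i)) - M.payment a i

/-- The expected welfare when the players use the mixed strategies `σ`. -/
def expectedWelfare (M : Auction k m) (v : Fin k → Valuation m)
    (σ : ∀ i, stdSimplex ℝ (M.Action i)) : ℝ :=
  mixedExpectation σ fun a => M.lotteryExpectation a (welfare v)

/-- The worst-case price of anarchy of `ε`-Nash equilibria with valuations in `V`: the supremum,
over all valuation profiles from `V` and all `ε`-Nash equilibria, of the ratio of the maximum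
welfare and the expected welfare of the equilibrium (`0 / 0` counts as `0`, and `x / 0` as `∞`
for `x > 0`). -/
def worstPOA (M : Auction k m) (V : Set (Valuation m)) (ε : ℝ) : ENNReal :=
  ⨆ (v : Fin k → V) (σ : ∀ i, stdSimplex ℝ (M.Action i))
    (_ : (M.game fun i => (v i : Valuation m)).IsEpsNash ε σ),
    ENNReal.ofReal (maxWelfare fun i => (v i : Valuation m)) /
      ENNReal.ofReal (M.expectedWelfare (fun i => (v i : Valuation m)) σ)

end Auction

end AuctionPOA

end

/-!
# Lower bounds on the price of anarchy from nondeterministic communication complexity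

If the limit superior were below `1`, then for some `ρ < 1` and all large `m` every `ε`-Nash
equilibrium of the auction would reach a fraction `1 / (ρ α)` of the maximum welfare. An equilibrium
would then be a witness that separates the two kinds of input: for a `1`-input no strategy profile
has expected welfare above `W / α`, whereas for a `0`-input every `ε`-Nash equilibrium has expected
welfare at least `W / (ρ α) > W / α`. So a prover can publish an equilibrium and the values that the
players get from it. Each player checks from its own valuation that it cannot gain more than `ε` by
deviating and that its value is not underreported (`Auction.exists_protocol`). The gap between the
two bounds pays for rounding the values.

Two facts make this a cheap protocol. Equilibria exist (`Game.exists_isEpsNash`): Nash's map on the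
product of simplices has a fixed point by Brouwer's theorem on the cube (`exists_fixed_point`),
which follows from Kuhn's labelling lemma (`rainbowParity_eq_one`). And equilibria have short
approximations (`Game.exists_sparse_isEpsNash`): the regrets of all players against all pure
deviations are multilinear in the strategies, so by a Chernoff bound (`exists_sample`) the
strategies can be replaced one by one by uniform distributions on
`O(k² (U / ε)² (k + log A))` sampled actions. With `A` sub-doubly-exponential and `U / ε`
polynomial, a certificate has subexponential length (`subexponential_cost`).
-/

namespace AuctionPOA

/-! ### Kuhn's cubical version of Sperner's lemma -/

/-- The determinant over `ZMod 2` of the matrix `[w j = c + s]` (rows `j`, columns `c`). It is `1`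
if `w` is a bijection onto `{s, …, s + n - 1}`, and `0` otherwise; as a determinant it
has a Laplace expansion, which replaces the usual door counting. -/
def labelDet {n : ℕ} (s : ℕ) (w : Fin n → ℕ) : ZMod 2 :=
  Matrix.det (Matrix.of fun j c : Fin n => if w j = (c : ℕ) + s then (1 : ZMod 2) else 0)

theorem labelDet_eq_zero {n : ℕ} {s : ℕ} {w : Fin n → ℕ} (c : Fin n)
    (h : ∀ j, w j ≠ c + s) : labelDet s w = 0 :=
  Matrix.det_eq_zero_of_column_eq_zero c fun j => by simp [h j]

/-- A simplex is rainbow iff it has an odd number of facets with exactly the nonzero labels. -/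
theorem labelDet_eq_sum_facets {n : ℕ} (w : Fin (n + 1) → ℕ) (hw : ∀ j, w j ≤ n) :
    labelDet 0 w = ∑ j : Fin (n + 1), labelDet 1 fun q : Fin n => w (j.succAbove q) := by
  -- Replace column `0` by the sum of all columns, which is the all-ones column, and expand.
  have h := Matrix.det_updateCol_sum
    (Matrix.of fun j c : Fin (n + 1) => if w j = (c : ℕ) + 0 then (1 : ZMod 2) else 0) 0
    (fun _ => 1)
  rw [one_smul] at h
  unfold labelDet
  rw [← h, Matrix.det_succ_column_zero]
  refine Finset.sum_congr rfl fun j _ => ?_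
  have h1 : ((-1 : ZMod 2)) = 1 := by decide
  have h2 : ∑ i : Fin (n + 1), (if w j = (i : ℕ) then (1 : ZMod 2) else 0) = 1 := by
    rw [Finset.sum_eq_single (⟨w j, Nat.lt_succ_of_le (hw j)⟩ : Fin (n + 1))]
    · simp
    · intro b _ hb
      rw [if_neg]
      rintro h
      exact hb (Fin.ext h.symm)
    · simp
  rw [h1, one_pow, one_mul]
  simp only [Matrix.updateCol_self, Matrix.of_apply, add_zero, smul_eq_mul, one_mul, h2]
  congr 1

/-- The vertices `0 ≤ j ≤ n` of the Freudenthal simplex at the corner `x` in which coordinate `i`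
is incremented in step `π i`. -/
def vertex {n : ℕ} (x : Fin n → ℕ) (π : Equiv.Perm (Fin n)) (j : ℕ) : Fin n → ℕ :=
  fun i => x i + if (π i : ℕ) < j then 1 else 0

/-- Parity of the number of rainbow Freudenthal simplices of the grid `{0, …, p} ^ n`. -/
def rainbowParity {n : ℕ} (p : ℕ) (l : (Fin n → ℕ) → ℕ) : ZMod 2 :=
  ∑ x : Fin n → Fin p, ∑ π : Equiv.Perm (Fin n),
    labelDet 0 fun j : Fin (n + 1) => l (vertex (fun i => x i) π j)

/-- The boundary conditions on a labelling of the grid `{0, …, p} ^ n`: coordinate `i` owns the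
label `i + 1`. -/
structure IsKuhnLabelling {n : ℕ} (p : ℕ) (l : (Fin n → ℕ) → ℕ) : Prop where
  le : ∀ x, l x ≤ n
  ne_of_zero : ∀ (x : Fin n → ℕ) (i : Fin n), x i = 0 → l x ≠ i + 1
  le_of_top : ∀ (x : Fin n → ℕ) (i : Fin n), x i = p → (i : ℕ) + 1 ≤ l x

/-- A facet through an interior vertex `j + 1` of a simplex is shared with the simplex in which the
steps `j` and `j + 1` are exchanged. -/
theorem sum_interior_facet {n : ℕ} (l : (Fin (n + 1) → ℕ) → ℕ) (x : Fin (n + 1) → ℕ)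
    (j : Fin n) :
    ∑ π : Equiv.Perm (Fin (n + 1)), labelDet 1
      (fun q : Fin (n + 1) => l (vertex x π (j.succ.castSucc.succAbove q))) = 0 := by
  refine Finset.sum_involution
    (fun π _ => (π.trans (Equiv.swap j.castSucc j.succ) : Equiv.Perm (Fin (n + 1))))
    ?_ ?_ (fun _ _ => Finset.mem_univ _) ?_
  · intro π _
    have : ∀ q : Fin (n + 1),
        vertex x (π.trans (Equiv.swap j.castSucc j.succ)) (j.succ.castSucc.succAbove q)
          = vertex x π (j.succ.castSucc.succAbove q) := by
      intro q
      funext i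
      have hq : ((j.succ.castSucc.succAbove q : Fin (n + 2)) : ℕ) ≠ j + 1 := by
        intro h
        exact Fin.succAbove_ne j.succ.castSucc q (Fin.ext (by simpa using h))
      generalize ((j.succ.castSucc.succAbove q : Fin (n + 2)) : ℕ) = t at hq
      simp only [vertex, Equiv.trans_apply]
      congr 1
      refine if_congr ?_ rfl rfl
      rcases eq_or_ne (π i) j.castSucc with h | h
      · rw [h, Equiv.swap_apply_left]
        simp
        omega
      rcases eq_or_ne (π i) j.succ with h' | h'
      · rw [h', Equiv.swap_apply_right]
        simp
        omega
      rw [Equiv.swap_apply_of_ne_of_ne h h']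
    simp only [this]
    exact CharTwo.add_self_eq_zero _
  · intro π _ _ h
    have := congrArg (fun σ : Equiv.Perm (Fin (n + 1)) => σ (π.symm j.castSucc)) h
    simp [Fin.ext_iff] at this
  · intro π _
    ext i
    simp

/-- The facet shared by two successive simplices in the direction `i` with `π i = 0`, in which it is
constant: it arises from `(z - e i, π)` by removing the first vertex, and from the simplex at `z`
whose steps are those of `π` shifted cyclically by removing the last one. -/
def outerFacet {n : ℕ} (l : (Fin (n + 1) → ℕ) → ℕ) (z : Fin (n + 1) → ℕ)
    (π : Equiv.Perm (Fin (n + 1))) : ZMod 2 :=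
  labelDet 1 fun q : Fin (n + 1) =>
    l fun i => z i + if 0 < (π i : ℕ) ∧ (π i : ℕ) ≤ q then 1 else 0

theorem first_facet {n : ℕ} (l : (Fin (n + 1) → ℕ) → ℕ) (x : Fin (n + 1) → ℕ)
    (π : Equiv.Perm (Fin (n + 1))) :
    (labelDet 1 fun q : Fin (n + 1) => l (vertex x π ((0 : Fin (n + 2)).succAbove q)))
      = outerFacet l (fun i => x i + if i = π.symm 0 then 1 else 0) π := by
  unfold outerFacet
  congr 1
  funext q
  congr 1
  funext i
  have : i = π.symm 0 ↔ (π i : ℕ) = 0 := by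
    rw [Equiv.eq_symm_apply, Fin.ext_iff]; simp
  have step : ∀ x a q : ℕ, (x + if a < q + 1 then 1 else 0)
      = x + (if a = 0 then 1 else 0) + if 0 < a ∧ a ≤ q then 1 else 0 := by
    intro x a q
    split_ifs <;> omega
  simp only [vertex, this, Fin.succAbove_zero, Fin.val_succ]
  convert step (x i) (π i) q using 2
  exact if_congr Iff.rfl rfl rfl

theorem last_facet {n : ℕ} (l : (Fin (n + 1) → ℕ) → ℕ) (x : Fin (n + 1) → ℕ)
    (π : Equiv.Perm (Fin (n + 1))) :
    (labelDet 1 fun q : Fin (n + 1) => l (vertex x (π.trans (finRotate (n + 1)).symm)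
      ((Fin.last (n + 1)).succAbove q))) = outerFacet l x π := by
  unfold outerFacet
  congr 1
  funext q
  congr 1
  funext i
  simp only [vertex, Equiv.trans_apply, Fin.succAbove_last, Fin.val_castSucc]
  congr 1
  refine if_congr ?_ rfl rfl
  have hq := q.2
  obtain ⟨t, ht⟩ : ∃ t, t = (finRotate (n + 1)).symm (π i) := ⟨_, rfl⟩
  have ht' : π i = finRotate (n + 1) t := by rw [ht, Equiv.apply_symm_apply]
  rw [← ht, ht', coe_finRotate]
  have := t.2
  split_ifs with h
  · subst h
    simp
    omega
  · omega

/-- Inside the grid the remaining facets telescope in the direction in which they are constant. -/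
theorem sum_outerFacets {n : ℕ} (p : ℕ) (l : (Fin (n + 1) → ℕ) → ℕ)
    (π : Equiv.Perm (Fin (n + 1))) :
    ∑ x : Fin (n + 1) → Fin p,
      (outerFacet l (fun i => x i + if i = π.symm 0 then 1 else 0) π
        + outerFacet l (fun i => x i) π)
    = ∑ y : Fin n → Fin p,
      (outerFacet l ((π.symm 0).insertNth p fun i => (y i : ℕ)) π
        + outerFacet l ((π.symm 0).insertNth 0 fun i => (y i : ℕ)) π) := by
  set a := π.symm 0
  rw [← (Fin.insertNthEquiv (fun _ => Fin p) a).sum_comp, Fintype.sum_prod_type_right]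
  refine Finset.sum_congr rfl fun y _ => ?_
  have e1 : ∀ t : Fin p, (fun i => ((Fin.insertNthEquiv (fun _ => Fin p) a (t, y) i : Fin p) : ℕ)
      + if i = a then 1 else 0) = a.insertNth ((t : ℕ) + 1) fun i => (y i : ℕ) := by
    intro t
    funext i
    refine Fin.succAboveCases a ?_ (fun i => ?_) i <;> simp [Fin.insertNthEquiv]
  have e2 : ∀ t : Fin p, (fun i => ((Fin.insertNthEquiv (fun _ => Fin p) a (t, y) i : Fin p) : ℕ))
      = a.insertNth (t : ℕ) fun i => (y i : ℕ) := by
    intro t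
    funext i
    refine Fin.succAboveCases a ?_ (fun i => ?_) i <;> simp [Fin.insertNthEquiv]
  simp only [e1, e2]
  rw [Fin.sum_univ_eq_sum_range (fun t =>
    outerFacet l (a.insertNth (t + 1) fun i => (y i : ℕ)) π
      + outerFacet l (a.insertNth t fun i => (y i : ℕ)) π) p]
  have := Finset.sum_range_sub (fun t => outerFacet l (a.insertNth t fun i => (y i : ℕ)) π) p
  simpa only [CharTwo.sub_eq_add] using this

theorem outerFacet_bottom {n p : ℕ} {l : (Fin (n + 1) → ℕ) → ℕ} (hl : IsKuhnLabelling p l)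
    (π : Equiv.Perm (Fin (n + 1))) (y : Fin n → ℕ) :
    outerFacet l ((π.symm 0).insertNth 0 y) π = 0 := by
  refine labelDet_eq_zero (π.symm 0) fun j => hl.ne_of_zero _ _ ?_
  simp

theorem outerFacet_top {n p : ℕ} {l : (Fin (n + 1) → ℕ) → ℕ} (hl : IsKuhnLabelling p l)
    (π : Equiv.Perm (Fin (n + 1))) (hπ : π.symm 0 ≠ 0) (y : Fin n → ℕ) :
    outerFacet l ((π.symm 0).insertNth p y) π = 0 := by
  refine labelDet_eq_zero 0 fun j h => ?_
  have := h ▸ hl.le_of_top _ (π.symm 0) (by simp)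
  have h0 : ((π.symm 0 : Fin (n + 1)) : ℕ) ≠ 0 := fun h => hπ (Fin.ext h)
  simp at this
  omega

theorem isKuhnLabelling_face {n p : ℕ} {l : (Fin (n + 1) → ℕ) → ℕ} (hl : IsKuhnLabelling p l) :
    IsKuhnLabelling p fun y : Fin n → ℕ => l (Fin.cons p y) - 1 where
  le y := by have := hl.le (Fin.cons p y); omega
  ne_of_zero y i h := by
    have := hl.ne_of_zero (Fin.cons p y) i.succ (by simpa using h)
    simp at this
    omega
  le_of_top y i h := by
    have := hl.le_of_top (Fin.cons p y) i.succ (by simpa using h)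
    simp at this
    omega

theorem outerFacet_cons {n p : ℕ} {l : (Fin (n + 1) → ℕ) → ℕ} (hl : IsKuhnLabelling p l)
    (π : Equiv.Perm (Fin n)) (y : Fin n → ℕ) :
    outerFacet l ((0 : Fin (n + 1)).insertNth p y) (Equiv.Perm.decomposeFin.symm (0, π)) =
      labelDet 0 fun q : Fin (n + 1) => l (Fin.cons p (vertex y π q)) - 1 := by
  unfold outerFacet labelDet
  congr 1
  ext q c
  have : (fun i => ((0 : Fin (n + 1)).insertNth (α := fun _ => ℕ) p y) i +
      if 0 < ((Equiv.Perm.decomposeFin.symm (0, π)) i : ℕ) ∧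
        ((Equiv.Perm.decomposeFin.symm (0, π)) i : ℕ) ≤ q then 1 else 0)
      = (Fin.cons p (vertex y π q) : Fin (n + 1) → ℕ) := by
    funext i
    refine Fin.cases ?_ (fun i => ?_) i
    · simp
    · simp [vertex]
  simp only [Matrix.of_apply, this]
  have := hl.le_of_top (Fin.cons p (vertex y π q)) 0 (by simp)
  refine if_congr ?_ rfl rfl
  simp at this
  omega

/-- **Kuhn's lemma**: the number of rainbow simplices is odd. -/
theorem rainbowParity_eq_one {n p : ℕ} {l : (Fin n → ℕ) → ℕ} (hl : IsKuhnLabelling p l) :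
    rainbowParity p l = 1 := by
  induction n with
  | zero =>
    have : ∀ x, l x = 0 := fun x => Nat.le_zero.1 (hl.le x)
    simp [rainbowParity, labelDet, this]
  | succ n ih =>
    have h1 : rainbowParity p l = ∑ π : Equiv.Perm (Fin (n + 1)), ∑ x : Fin (n + 1) → Fin p,
        (outerFacet l (fun i => x i + if i = π.symm 0 then 1 else 0) π
          + outerFacet l (fun i => x i) π) := by
      rw [Finset.sum_comm]
      unfold rainbowParity
      refine Finset.sum_congr rfl fun x _ => ?_
      simp_rw [labelDet_eq_sum_facets _ fun j => hl.le _]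
      rw [Finset.sum_comm, Fin.sum_univ_succ, Fin.sum_univ_castSucc, Finset.sum_add_distrib]
      congr 1
      · exact Finset.sum_congr rfl fun π _ => first_facet l _ π
      · rw [Finset.sum_eq_zero, zero_add]
        · rw [Fin.succ_last,
            ← Equiv.sum_comp (Equiv.mulLeft (finRotate (n + 1)).symm)]
          exact Finset.sum_congr rfl fun π _ => last_facet l _ π
        · exact fun j _ => sum_interior_facet l _ j
    rw [h1]
    simp_rw [sum_outerFacets, outerFacet_bottom hl, add_zero]
    rw [← ih (isKuhnLabelling_face hl)]
    unfold rainbowParity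
    rw [Finset.sum_comm (s := (Finset.univ : Finset (Fin n → Fin p))),
      ← Equiv.sum_comp Equiv.Perm.decomposeFin.symm, Fintype.sum_prod_type,
      Finset.sum_eq_single 0]
    · refine Finset.sum_congr rfl fun π _ => Finset.sum_congr rfl fun y _ => ?_
      have : (Equiv.Perm.decomposeFin.symm ((0 : Fin (n + 1)), π)).symm 0 = 0 := by
        rw [Equiv.symm_apply_eq]; simp
      rw [this]
      exact outerFacet_cons hl π _
    · intro a _ ha
      refine Finset.sum_eq_zero fun π _ => Finset.sum_eq_zero fun y _ => outerFacet_top hl _ ?_ _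
      rw [ne_eq, Equiv.symm_apply_eq]
      simpa [eq_comm] using ha
    · simp

theorem exists_rainbow {n p : ℕ} {l : (Fin n → ℕ) → ℕ} (hl : IsKuhnLabelling p l) :
    ∃ (x : Fin n → Fin p) (π : Equiv.Perm (Fin n)),
      ∀ c ≤ n, ∃ j : ℕ, l (vertex (fun i => x i) π j) = c := by
  have h : rainbowParity p l ≠ 0 := by rw [rainbowParity_eq_one hl]; decide
  obtain ⟨x, -, hx⟩ := Finset.exists_ne_zero_of_sum_ne_zero h
  obtain ⟨π, -, hπ⟩ := Finset.exists_ne_zero_of_sum_ne_zero hx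
  refine ⟨x, π, fun c hc => ?_⟩
  by_contra! hcon
  exact hπ (labelDet_eq_zero ⟨c, Nat.lt_succ_of_le hc⟩ fun j => hcon j)

/-! ### Brouwer's fixed point theorem on the cube -/

theorem exists_isKuhnLabelling {n p : ℕ} (D : (Fin n → ℕ) → Fin n → Prop)
    (h0 : ∀ x i, x i = 0 → ¬ D x i) (h1 : ∀ x i, x i = p → D x i) :
    ∃ l, IsKuhnLabelling p l ∧ (∀ x (i : Fin n), l x = (i : ℕ) + 1 → D x i) ∧
      ∀ x (i : Fin n), l x ≤ i → ¬ D x i := by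
  classical
  -- The label of `x` is `i + 1` for the largest `i` with `D x i`, and `0` if there is none.
  let l : (Fin n → ℕ) → ℕ := fun x =>
    (Finset.univ.filter fun i => D x i).sup fun i : Fin n => (i : ℕ) + 1
  have hge : ∀ x (i : Fin n), D x i → (i : ℕ) + 1 ≤ l x := fun x i hi =>
    Finset.le_sup (f := fun i : Fin n => (i : ℕ) + 1) (by simpa using hi)
  have heq : ∀ x (i : Fin n), l x = (i : ℕ) + 1 → D x i := by
    intro x i hi
    have hne : (Finset.univ.filter fun i => D x i).Nonempty := by
      by_contra hcon
      rw [Finset.not_nonempty_iff_eq_empty] at hcon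
      simp [l, hcon] at hi
    obtain ⟨j, hj, hlj⟩ := Finset.exists_mem_eq_sup _ hne fun i : Fin n => (i : ℕ) + 1
    have hij : i = j := Fin.ext (by simpa [l, hi] using hi.symm.trans hlj)
    rw [hij]
    simpa using hj
  refine ⟨l, ⟨fun x => Finset.sup_le fun i _ => i.2, fun x i hi h => h0 x i hi (heq x i h),
    fun x i hi => hge x i (h1 x i hi)⟩, heq, fun x i hi hD => ?_⟩
  have := hge x i hD
  omega

/-- A point within distance `1 / p` of which each coordinate of `f - id` takes both signs: the
corner of a rainbow simplex, where the vertices labelled `i` and `i + 1` serve for coordinate `i`. -/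
theorem exists_approx_fixed {n : ℕ} {f : (Fin n → ℝ) → Fin n → ℝ}
    (hf : ∀ x i, f x i ∈ Set.Icc (0 : ℝ) 1) (p : ℕ) (hp : 0 < p) :
    ∃ x ∈ Set.Icc (0 : Fin n → ℝ) 1, ∀ i, ∃ u v : Fin n → ℝ,
      dist u x ≤ 1 / p ∧ dist v x ≤ 1 / p ∧ f u i ≤ u i ∧ v i ≤ f v i := by
  have hp' : (0 : ℝ) < p := by exact_mod_cast hp
  let g : (Fin n → ℕ) → Fin n → ℝ := fun x i => (x i : ℝ) / p
  obtain ⟨l, hl, hD, hnD⟩ := exists_isKuhnLabelling (p := p)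
    (fun x i => x i ≠ 0 ∧ f (g x) i ≤ g x i) (fun x i hx h => h.1 hx) (fun x i hx => by
      refine ⟨by omega, (hf _ i).2.trans ?_⟩
      simp [g, hx, hp'.ne'])
  obtain ⟨x, π, hx⟩ := exists_rainbow hl
  have hdist : ∀ j, dist (g (vertex (fun i => x i) π j)) (g fun i => x i) ≤ 1 / p := by
    intro j
    refine (dist_pi_le_iff (by positivity)).2 fun i => ?_
    rw [Real.dist_eq]
    simp only [g, vertex]
    rw [← sub_div, abs_div, abs_of_pos hp']
    gcongr
    split_ifs <;> simp
  refine ⟨g fun i => x i, ⟨fun i => by simp only [g]; positivity, fun i => ?_⟩, fun i => ?_⟩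
  · have : ((x i : ℕ) : ℝ) ≤ p := by exact_mod_cast (x i).2.le
    simpa [g] using div_le_one_of_le₀ this hp'.le
  · obtain ⟨j, hj⟩ := hx (i + 1) i.2
    obtain ⟨j', hj'⟩ := hx i i.2.le
    refine ⟨_, _, hdist j, hdist j', (hD _ _ hj).2, ?_⟩
    have := hnD _ _ hj'.le
    by_cases h : vertex (fun i => x i) π j' i = 0
    · have : g (vertex (fun i => x i) π j') i = 0 := by simp only [g, h]; simp
      rw [this]
      exact (hf _ i).1
    · exact (not_le.1 fun h' => this ⟨h, h'⟩).le

/-- **Brouwer's fixed point theorem** for the cube `[0, 1] ^ n`. -/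
theorem exists_fixed_point {n : ℕ} {f : (Fin n → ℝ) → Fin n → ℝ} (hc : Continuous f)
    (hf : ∀ x i, f x i ∈ Set.Icc (0 : ℝ) 1) : ∃ x, f x = x := by
  choose x hxmem u v hu hv hfu hfv using fun p : ℕ => exists_approx_fixed hf (p + 1) p.succ_pos
  obtain ⟨a, -, φ, hφ, ha⟩ := isCompact_Icc.tendsto_subseq hxmem
  have hlim : ∀ w : ℕ → Fin n → ℝ, (∀ p, dist (w p) (x p) ≤ 1 / ((p + 1 : ℕ) : ℝ)) →
      Tendsto (w ∘ φ) atTop (nhds a) := by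
    intro w hw
    refine (tendsto_iff_of_dist ?_).2 ha
    refine squeeze_zero (fun _ => dist_nonneg) (fun p => hw (φ p)) ?_
    have := (tendsto_one_div_add_atTop_nhds_zero_nat (𝕜 := ℝ)).comp hφ.tendsto_atTop
    simpa [Function.comp_def] using this
  refine ⟨a, funext fun i => ?_⟩
  have hi : Continuous fun y => f y i := (continuous_apply i).comp hc
  have hu' := hlim (fun p => u p i) fun p => hu p i
  have hv' := hlim (fun p => v p i) fun p => hv p i
  exact le_antisymm
    (le_of_tendsto_of_tendsto' ((hi.tendsto a).comp hu')
      (((continuous_apply i).tendsto a).comp hu') fun p => hfu (φ p) i)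
    (le_of_tendsto_of_tendsto' (((continuous_apply i).tendsto a).comp hv')
      ((hi.tendsto a).comp hv') fun p => hfv (φ p) i)

/-- Brouwer's theorem with coordinates in an arbitrary finite type. -/
theorem exists_fixed_point_of_fintype {ι : Type*} [Finite ι] {f : (ι → ℝ) → ι → ℝ}
    (hc : Continuous f) (hf : ∀ x i, f x i ∈ Set.Icc (0 : ℝ) 1) : ∃ x, f x = x := by
  obtain ⟨n, ⟨e⟩⟩ := Finite.exists_equiv_fin ι
  obtain ⟨x, hx⟩ := exists_fixed_point (f := fun y i => f (y ∘ e) (e.symm i))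
    (continuous_pi fun i => (continuous_apply _).comp
      (hc.comp (continuous_pi fun j => continuous_apply (e j)))) fun y i => hf _ _
  refine ⟨x ∘ e, funext fun i => ?_⟩
  simpa using congrFun hx (e i)

/-! ### Existence of Nash equilibria -/

theorem exists_retraction_stdSimplex (A : Type*) [Fintype A] [Nonempty A] :
    ∃ ρ : (A → ℝ) → A → ℝ, Continuous ρ ∧ (∀ x, ρ x ∈ stdSimplex ℝ A) ∧
      ∀ x ∈ stdSimplex ℝ A, ρ x = x := by
  -- Fill the missing mass uniformly; scale excess mass down.
  let S : (A → ℝ) → ℝ := fun x => ∑ a, max (x a) 0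
  have hS : Continuous S := by fun_prop
  have hcard : (0 : ℝ) < Fintype.card A := by exact_mod_cast Fintype.card_pos
  have hmax : ∀ x, 0 < max 1 (S x) := fun x => lt_max_of_lt_left one_pos
  refine ⟨fun x a => (max (x a) 0 + max (1 - S x) 0 / Fintype.card A) / max 1 (S x),
    continuous_pi fun a => ?_, fun x => ⟨fun a => ?_, ?_⟩, fun x hx => ?_⟩
  · exact Continuous.div (by fun_prop) (by fun_prop) fun x => (hmax x).ne'
  · have := hmax x
    positivity
  · rw [← Finset.sum_div, div_eq_one_iff_eq (hmax x).ne', Finset.sum_add_distrib, Finset.sum_const,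
      Finset.card_univ, nsmul_eq_mul, mul_div_cancel₀ _ hcard.ne']
    change S x + _ = _
    rcases le_total (S x) 1 with h | h
    · rw [max_eq_left (by linarith), max_eq_left h]; ring
    · rw [max_eq_right (by linarith), max_eq_right h]; ring
  · have h0 : ∀ a, max (x a) 0 = x a := fun a => max_eq_left (hx.1 a)
    have h1 : S x = 1 := by simp only [S, h0, hx.2]
    funext a
    simp [h0, h1]

theorem prod_update {k : ℕ} {Act : Fin k → Type} (w : ∀ i, Act i → ℝ) (i : Fin k)
    (t : Act i → ℝ) (a : ∀ i, Act i) :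
    ∏ j, Function.update w i t j (a j) = t (a i) * ∏ j ∈ Finset.univ.erase i, w j (a j) := by
  rw [← Finset.mul_prod_erase _ _ (Finset.mem_univ i), Function.update_self]
  congr 1
  refine Finset.prod_congr rfl fun j hj => ?_
  rw [Function.update_of_ne (Finset.ne_of_mem_erase hj)]

section Multilinear

variable {k : ℕ} {Act : Fin k → Type} [∀ i, Fintype (Act i)]

/-- The multilinear extension of `f` to arbitrary weights; `mixedExpectation` is its restriction to
mixed strategies. -/
def weightedSum (w : ∀ i, Act i → ℝ) (f : (∀ i, Act i) → ℝ) : ℝ :=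
  ∑ a : ∀ i, Act i, (∏ i, w i (a i)) * f a

theorem mixedExpectation_eq_weightedSum (σ : ∀ i, stdSimplex ℝ (Act i))
    (f : (∀ i, Act i) → ℝ) : mixedExpectation σ f = weightedSum (fun i => (σ i).1) f := rfl

theorem mixedExpectation_update (σ : ∀ i, stdSimplex ℝ (Act i)) (i : Fin k)
    (τ : stdSimplex ℝ (Act i)) (f : (∀ i, Act i) → ℝ) :
    mixedExpectation (Function.update σ i τ) f =
      weightedSum (Function.update (fun i => (σ i).1) i τ.1) f := by
  rw [mixedExpectation_eq_weightedSum]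
  congr 1
  funext j
  exact Function.apply_update (fun j (s : stdSimplex ℝ (Act j)) => s.1) σ i τ j

/-- The payoff against the others' strategies of the pure strategy `b` of player `i`. -/
noncomputable def pureDeviation (w : ∀ i, Act i → ℝ) (f : (∀ i, Act i) → ℝ) (i : Fin k)
    (b : Act i) : ℝ :=
  open Classical in weightedSum (Function.update w i (Pi.single b 1)) f

/-- The payoff is linear in the strategy of each player. -/
theorem weightedSum_update (w : ∀ i, Act i → ℝ) (f : (∀ i, Act i) → ℝ) (i : Fin k)
    (t : Act i → ℝ) :
    weightedSum (Function.update w i t) f = ∑ b, t b * pureDeviation w f i b := by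
  classical
  unfold pureDeviation weightedSum
  simp_rw [prod_update, Finset.mul_sum]
  rw [Finset.sum_comm]
  refine Finset.sum_congr rfl fun a _ => ?_
  rw [Finset.sum_eq_single (a i)]
  · simp [mul_assoc]
  · intro b _ hb
    simp [hb.symm]
  · simp

theorem weightedSum_eq_sum_pureDeviation (w : ∀ i, Act i → ℝ) (f : (∀ i, Act i) → ℝ)
    (i : Fin k) : weightedSum w f = ∑ b, w i b * pureDeviation w f i b := by
  rw [← weightedSum_update, Function.update_eq_self]

theorem weightedSum_one {w : ∀ i, Act i → ℝ} (hw : ∀ i, w i ∈ stdSimplex ℝ (Act i)) :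
    ∑ a : ∀ i, Act i, ∏ i, w i (a i) = 1 := by
  rw [← Fintype.piFinset_univ, ← Finset.prod_univ_sum, Finset.prod_eq_one fun i _ => (hw i).2]

theorem weightedSum_mem_Icc {w : ∀ i, Act i → ℝ} (hw : ∀ i, w i ∈ stdSimplex ℝ (Act i))
    {f : (∀ i, Act i) → ℝ} {l u : ℝ} (hf : ∀ a, f a ∈ Set.Icc l u) :
    weightedSum w f ∈ Set.Icc l u := by
  have h0 : ∀ a : ∀ i, Act i, 0 ≤ ∏ i, w i (a i) := fun a =>
    Finset.prod_nonneg fun i _ => (hw i).1 _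
  have h1 : ∀ c, ∑ a : ∀ i, Act i, (∏ i, w i (a i)) * c = c := fun c => by
    rw [← Finset.sum_mul, weightedSum_one hw, one_mul]
  constructor
  · rw [← h1 l]
    exact Finset.sum_le_sum fun a _ => mul_le_mul_of_nonneg_left (hf a).1 (h0 a)
  · rw [← h1 u]
    exact Finset.sum_le_sum fun a _ => mul_le_mul_of_nonneg_left (hf a).2 (h0 a)

theorem pureDeviation_mem_Icc {w : ∀ i, Act i → ℝ} (hw : ∀ i, w i ∈ stdSimplex ℝ (Act i))
    {f : (∀ i, Act i) → ℝ} {l u : ℝ} (hf : ∀ a, f a ∈ Set.Icc l u) (i : Fin k) (b : Act i) :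
    pureDeviation w f i b ∈ Set.Icc l u := by
  classical
  refine weightedSum_mem_Icc (fun j => ?_) hf
  rcases eq_or_ne j i with rfl | h
  · rw [Function.update_self]
    convert single_mem_stdSimplex ℝ b
  · rw [Function.update_of_ne h]
    exact hw j

theorem continuous_weightedSum (f : (∀ i, Act i) → ℝ) :
    Continuous fun w : ∀ i, Act i → ℝ => weightedSum w f := by
  unfold weightedSum
  fun_prop

theorem continuous_pureDeviation (f : (∀ i, Act i) → ℝ) (i : Fin k) (b : Act i) :
    Continuous fun w : ∀ i, Act i → ℝ => pureDeviation w f i b := by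
  classical
  exact (continuous_weightedSum f).comp (continuous_id.update i continuous_const)

end Multilinear

/-- It suffices to consider deviations to pure strategies. -/
theorem Game.isEpsNash_iff {k : ℕ} (G : Game k) (ε : ℝ) (σ : ∀ i, stdSimplex ℝ (G.Action i)) :
    G.IsEpsNash ε σ ↔ ∀ i b, pureDeviation (fun i => (σ i).1) (fun a => G.utility a i) i b ≤
      weightedSum (fun i => (σ i).1) (fun a => G.utility a i) + ε := by
  classical
  constructor
  · intro h i b
    have := h i ⟨Pi.single b 1, single_mem_stdSimplex ℝ b⟩
    rw [mixedExpectation_update, mixedExpectation_eq_weightedSum] at this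
    unfold pureDeviation
    convert this
  · intro h i τ
    rw [mixedExpectation_update, weightedSum_update, mixedExpectation_eq_weightedSum]
    have : ∑ b, τ.1 b * (weightedSum (fun i => (σ i).1) (fun a => G.utility a i) + ε)
        = weightedSum (fun i => (σ i).1) (fun a => G.utility a i) + ε := by
      rw [← Finset.sum_mul, τ.2.2, one_mul]
    rw [← this]
    exact Finset.sum_le_sum fun b _ => mul_le_mul_of_nonneg_left (h i b) (τ.2.1 b)

/-- At a fixed point of Nash's map no pure strategy has a positive gain: if one had, exactly the
strategies in the support would have a positive gain over their own average. -/
theorem gain_le_zero {A : Type*} [Fintype A] {p g : A → ℝ} (hp : p ∈ stdSimplex ℝ A)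
    (h : ∀ b, (p b + max (g b - ∑ c, p c * g c) 0) / (1 + ∑ d, max (g d - ∑ c, p c * g c) 0) = p b)
    (b : A) : g b ≤ ∑ c, p c * g c := by
  set v := ∑ c, p c * g c with hv
  set S := ∑ d, max (g d - v) 0 with hS
  have hS0 : 0 ≤ S := Finset.sum_nonneg fun _ _ => le_max_right _ _
  have h' : ∀ b, max (g b - v) 0 = p b * S := by
    intro b
    have := (div_eq_iff (by positivity)).1 (h b)
    linarith
  rcases hS0.eq_or_lt with hs | hs
  · have := (le_max_left (g b - v) 0).trans (h' b).le
    rw [← hs, mul_zero] at this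
    linarith
  have hzero : ∑ b, p b * (g b - v) = 0 := by
    simp_rw [mul_sub]
    rw [Finset.sum_sub_distrib, ← Finset.sum_mul, hp.2, ← hv]
    ring
  have hnn : ∀ b ∈ Finset.univ, 0 ≤ p b * (g b - v) := by
    intro b _
    rcases (hp.1 b).eq_or_lt with h0 | h0
    · rw [← h0, zero_mul]
    · have : 0 < max (g b - v) 0 := by rw [h' b]; positivity
      have := (lt_max_iff.1 this).resolve_right (lt_irrefl 0)
      positivity
  have hall := (Finset.sum_eq_zero_iff_of_nonneg hnn).1 hzero
  by_contra! hlt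
  have hpos : 0 < p b * S := by rw [← h' b]; exact lt_max_of_lt_left (sub_pos.2 hlt)
  have hpb : 0 < p b := (hp.1 b).lt_of_ne fun h0 => by rw [← h0, zero_mul] at hpos; exact hpos.false
  exact (mul_pos hpb (sub_pos.2 hlt)).ne' (hall b (Finset.mem_univ b))

/-- **Nash's theorem.** -/
theorem Game.exists_isEpsNash {k : ℕ} (G : Game k) : ∃ σ, G.IsEpsNash 0 σ := by
  choose ρ hρc hρm hρi using fun i => exists_retraction_stdSimplex (G.Action i)
  let u : ∀ i, (∀ i, G.Action i) → ℝ := fun i a => G.utility a i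
  let gain : (∀ i, G.Action i → ℝ) → ∀ i, G.Action i → ℝ := fun w i b =>
    max (pureDeviation w (u i) i b - ∑ c, w i c * pureDeviation w (u i) i c) 0
  let N : (∀ i, G.Action i → ℝ) → ∀ i, G.Action i → ℝ := fun w i b =>
    (w i b + gain w i b) / (1 + ∑ d, gain w i d)
  have hg0 : ∀ w i b, 0 ≤ gain w i b := fun _ _ _ => le_max_right _ _
  have hden : ∀ w i, 0 < 1 + ∑ d, gain w i d := fun w i =>
    add_pos_of_pos_of_nonneg one_pos (Finset.sum_nonneg fun _ _ => hg0 _ _ _)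
  have hgc : ∀ i b, Continuous fun w => gain w i b := by
    intro i b
    have := fun c => continuous_pureDeviation (u i) i c
    simp only [gain]
    fun_prop
  have hNc : ∀ i b, Continuous fun w => N w i b := by
    intro i b
    have := hgc i
    exact Continuous.div (by fun_prop) (by fun_prop) fun w => (hden w i).ne'
  have hNm : ∀ w, (∀ i, w i ∈ stdSimplex ℝ (G.Action i)) → ∀ i,
      N w i ∈ stdSimplex ℝ (G.Action i) := by
    intro w hw i
    refine ⟨fun b => div_nonneg (add_nonneg ((hw i).1 b) (hg0 _ _ _)) (hden w i).le, ?_⟩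
    rw [← Finset.sum_div, Finset.sum_add_distrib, (hw i).2, div_self (hden w i).ne']
  let R : ((Σ i, G.Action i) → ℝ) → ∀ i, G.Action i → ℝ := fun x i => ρ i fun b => x ⟨i, b⟩
  have hR : ∀ x i, R x i ∈ stdSimplex ℝ (G.Action i) := fun x i => hρm i _
  have hRc : Continuous R := continuous_pi fun i => (hρc i).comp (by fun_prop)
  obtain ⟨x, hx⟩ := exists_fixed_point_of_fintype (ι := Σ i, G.Action i)
    (f := fun x ib => N (R x) ib.1 ib.2)
    (continuous_pi fun ib => (hNc ib.1 ib.2).comp hRc)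
    (fun x ib => mem_Icc_of_mem_stdSimplex (hNm _ (hR x) ib.1) ib.2)
  have hx' : ∀ i b, N (R x) i b = x ⟨i, b⟩ := fun i b => congrFun hx ⟨i, b⟩
  have hfix : ∀ i b, N (R x) i b = R x i b := by
    intro i b
    have : (fun b => x ⟨i, b⟩) ∈ stdSimplex ℝ (G.Action i) := by
      convert hNm _ (hR x) i using 1
      exact funext fun b => (hx' i b).symm
    rw [hx', show R x i = fun b => x ⟨i, b⟩ from hρi i _ this]
  refine ⟨fun i => ⟨R x i, hR x i⟩, (G.isEpsNash_iff _ _).2 fun i b => ?_⟩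
  rw [add_zero, weightedSum_eq_sum_pureDeviation _ _ i]
  exact gain_le_zero (hR x i) (hfix i) b

/-! ### Closure properties of subexponential growth -/

/-- The bound of rate `δ` in the definition of `Subexponential`. -/
noncomputable def expBound : ExpScale → ℝ → ℕ → ℝ
  | .linear, δ, m => (2 : ℝ) ^ (δ * (m : ℝ))
  | .power, δ, m => (2 : ℝ) ^ ((m : ℝ) ^ δ)

theorem subexponential_iff {s : ExpScale} {f : ℕ → ℝ} :
    Subexponential s f ↔ ∀ δ : ℝ, 0 < δ → ∀ᶠ m in atTop, f m ≤ expBound s δ m := by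
  cases s <;> rfl

theorem eventually_expBound_half (s : ExpScale) {δ : ℝ} (hδ : 0 < δ) :
    ∀ᶠ m in atTop, 2 ≤ expBound s (δ / 2) m ∧ expBound s (δ / 2) m ^ 2 ≤ expBound s δ m := by
  have hδ2 : 0 < δ / 2 := by positivity
  cases s with
  | linear =>
    have h : Tendsto (fun m : ℕ => δ / 2 * (m : ℝ)) atTop atTop :=
      tendsto_natCast_atTop_atTop.const_mul_atTop hδ2
    filter_upwards [h.eventually_ge_atTop 1] with m hm
    refine ⟨?_, ?_⟩
    · simpa [expBound] using Real.rpow_le_rpow_of_exponent_le one_le_two hm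
    · simp only [expBound]
      rw [← Real.rpow_natCast, ← Real.rpow_mul zero_le_two]
      exact (congrArg _ (by push_cast; ring)).le
  | power =>
    have h : Tendsto (fun m : ℕ => (m : ℝ) ^ (δ / 2)) atTop atTop :=
      (tendsto_rpow_atTop hδ2).comp tendsto_natCast_atTop_atTop
    filter_upwards [h.eventually_ge_atTop 2] with m hm
    refine ⟨?_, ?_⟩
    · simpa [expBound] using
        Real.rpow_le_rpow_of_exponent_le one_le_two (one_le_two.trans hm)
    · simp only [expBound]
      rw [← Real.rpow_natCast, ← Real.rpow_mul zero_le_two]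
      refine Real.rpow_le_rpow_of_exponent_le one_le_two ?_
      have : (m : ℝ) ^ δ = (m : ℝ) ^ (δ / 2) * (m : ℝ) ^ (δ / 2) := by
        rw [← Real.rpow_add_of_nonneg (Nat.cast_nonneg m) hδ2.le hδ2.le, add_halves]
      rw [this]
      push_cast
      nlinarith

namespace Subexponential

variable {s : ExpScale} {f g : ℕ → ℝ}

theorem mono (hg : Subexponential s g) (h : ∀ᶠ m in atTop, f m ≤ g m) : Subexponential s f := by
  rw [subexponential_iff] at *
  intro δ hδ
  filter_upwards [hg δ hδ, h] with m h1 h2 using h2.trans h1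

theorem add (hf : Subexponential s f) (hg : Subexponential s g) :
    Subexponential s fun m => f m + g m := by
  rw [subexponential_iff] at *
  intro δ hδ
  filter_upwards [hf _ (half_pos hδ), hg _ (half_pos hδ), eventually_expBound_half s hδ]
    with m h1 h2 h3
  nlinarith [h3.1, h3.2]

theorem mul (hf : Subexponential s f) (hg : Subexponential s g) (hf0 : ∀ m, 0 ≤ f m)
    (hg0 : ∀ m, 0 ≤ g m) : Subexponential s fun m => f m * g m := by
  rw [subexponential_iff] at *
  intro δ hδ
  filter_upwards [hf _ (half_pos hδ), hg _ (half_pos hδ), eventually_expBound_half s hδ]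
    with m h1 h2 h3
  refine le_trans ?_ h3.2
  rw [sq]
  exact mul_le_mul h1 h2 (hg0 m) ((hf0 m).trans h1)

theorem natCast (s : ExpScale) : Subexponential s fun m => (m : ℝ) := by
  -- Both scales dominate `m` because `log m` is negligible against `m` and against `m ^ δ`.
  have key : ∀ c r : ℝ, 0 < c → 0 < r → ∀ᶠ m : ℕ in atTop,
      (m : ℝ) ≤ (2 : ℝ) ^ (c * (m : ℝ) ^ r) := by
    intro c r hc hr
    have hl : 0 < Real.log 2 := Real.log_pos one_lt_two
    have h := ((isLittleO_log_rpow_atTop hr).comp_tendsto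
      (tendsto_natCast_atTop_atTop (R := ℝ))).bound (mul_pos hl hc)
    filter_upwards [h, eventually_gt_atTop 0] with m hm hm0
    have hm0' : (0 : ℝ) < m := by exact_mod_cast hm0
    rw [Real.rpow_def_of_pos two_pos]
    refine (Real.log_le_iff_le_exp hm0').1 ((le_abs_self _).trans ?_)
    simp only [Function.comp, Real.norm_eq_abs] at hm
    rwa [abs_of_nonneg (Real.rpow_nonneg hm0'.le r), mul_assoc] at hm
  cases s with
  | linear =>
    intro δ hδ
    simpa using key δ 1 hδ one_pos
  | power =>
    intro δ hδ
    simpa using key 1 δ one_pos hδ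

theorem const (s : ExpScale) (c : ℝ) : Subexponential s fun _ => c :=
  (natCast s).mono (tendsto_natCast_atTop_atTop.eventually_ge_atTop c)

theorem abs_eval {k : ℕ → ℕ} (hk : Subexponential s fun m => (k m : ℝ))
    (P : MvPolynomial (Fin 2) ℝ) :
    Subexponential s fun m => |MvPolynomial.eval ![(k m : ℝ), (m : ℝ)] P| := by
  induction P using MvPolynomial.induction_on with
  | C a => simpa using const s |a|
  | add p q hp hq =>
    refine (hp.add hq).mono (Eventually.of_forall fun m => ?_)
    rw [map_add]
    exact abs_add_le _ _
  | mul_X p i hp =>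
    have hX : Subexponential s fun m => |(![(k m : ℝ), (m : ℝ)] : Fin 2 → ℝ) i| := by
      fin_cases i
      · simpa using hk
      · simpa using natCast s
    simpa [abs_mul] using hp.mul hX (fun _ => abs_nonneg _) fun _ => abs_nonneg _

end Subexponential

/-! ### Sparse approximations of mixed strategies -/

/-- One step of the method of conditional expectations: the exponential potential grows by a factor
of at most `exp (lam ^ 2)` on average over `p`, hence for some `a`. -/
theorem exists_exp_step {A T : Type*} [Fintype A] [Fintype T] {p : A → ℝ}
    (hp : p ∈ stdSimplex ℝ A) {g : T → A → ℝ} (hg : ∀ t a, |g t a| ≤ 1)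
    (hg0 : ∀ t, ∑ a, p a * g t a = 0) {lam : ℝ} (hlam0 : 0 ≤ lam) (hlam : lam ≤ 1)
    {c : T → ℝ} (hc : ∀ t, 0 ≤ c t) :
    ∃ a, ∑ t, c t * Real.exp (lam * g t a) ≤ (∑ t, c t) * Real.exp (lam ^ 2) := by
  have hexp : ∀ t a, Real.exp (lam * g t a) ≤ 1 + lam * g t a + lam ^ 2 := by
    intro t a
    have h1 : |lam * g t a| ≤ lam := by
      rw [abs_mul, abs_of_nonneg hlam0]
      exact mul_le_of_le_one_right hlam0 (hg t a)
    have h2 := (abs_le.1 (Real.abs_exp_sub_one_sub_id_le (h1.trans hlam))).2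
    have h3 : (lam * g t a) ^ 2 ≤ lam ^ 2 := sq_le_sq' (by linarith [(abs_le.1 h1).1])
      (abs_le.1 h1).2
    linarith
  have hmean : ∀ t, ∑ a, p a * Real.exp (lam * g t a) ≤ Real.exp (lam ^ 2) := by
    intro t
    calc ∑ a, p a * Real.exp (lam * g t a) ≤ ∑ a, p a * (1 + lam * g t a + lam ^ 2) :=
          Finset.sum_le_sum fun a _ => mul_le_mul_of_nonneg_left (hexp t a) (hp.1 a)
      _ = (∑ a, p a) * (1 + lam ^ 2) + lam * ∑ a, p a * g t a := by
          rw [Finset.sum_mul, Finset.mul_sum, ← Finset.sum_add_distrib]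
          exact Finset.sum_congr rfl fun a _ => by ring
      _ = lam ^ 2 + 1 := by rw [hp.2, hg0]; ring
      _ ≤ _ := Real.add_one_le_exp _
  by_contra! hcon
  have hpos : ∃ a ∈ Finset.univ, 0 < p a :=
    Finset.exists_lt_of_sum_lt (by simp [hp.2])
  have h1 : ∑ a, p a * ((∑ t, c t) * Real.exp (lam ^ 2)) <
      ∑ a, p a * ∑ t, c t * Real.exp (lam * g t a) := by
    obtain ⟨a, ha, ha'⟩ := hpos
    exact Finset.sum_lt_sum (fun a _ => mul_le_mul_of_nonneg_left (hcon a).le (hp.1 a))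
      ⟨a, ha, mul_lt_mul_of_pos_left (hcon a) ha'⟩
  rw [← Finset.sum_mul, hp.2, one_mul] at h1
  refine h1.not_ge ?_
  simp_rw [Finset.mul_sum]
  rw [Finset.sum_comm, Finset.sum_mul]
  refine Finset.sum_le_sum fun t _ => ?_
  calc ∑ a, p a * (c t * Real.exp (lam * g t a)) = c t * ∑ a, p a * Real.exp (lam * g t a) := by
        rw [Finset.mul_sum]
        exact Finset.sum_congr rfl fun a _ => by ring
    _ ≤ _ := mul_le_mul_of_nonneg_left (hmean t) (hc t)

theorem exists_exp_sample {A T : Type*} [Fintype A] [Fintype T] {p : A → ℝ}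
    (hp : p ∈ stdSimplex ℝ A) {g : T → A → ℝ} (hg : ∀ t a, |g t a| ≤ 1)
    (hg0 : ∀ t, ∑ a, p a * g t a = 0) {lam : ℝ} (hlam0 : 0 ≤ lam) (hlam : lam ≤ 1) (s : ℕ) :
    ∃ x : Fin s → A, ∑ t, Real.exp (lam * ∑ q, g t (x q)) ≤
      Fintype.card T * Real.exp (s * lam ^ 2) := by
  induction s with
  | zero => exact ⟨Fin.elim0, by simp⟩
  | succ s ih =>
    obtain ⟨x, hx⟩ := ih
    obtain ⟨a, ha⟩ := exists_exp_step hp hg hg0 hlam0 hlam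
      (c := fun t => Real.exp (lam * ∑ q, g t (x q))) fun t => (Real.exp_pos _).le
    refine ⟨Fin.snoc x a, ?_⟩
    simp only [Fin.sum_univ_castSucc, Fin.snoc_castSucc, Fin.snoc_last, mul_add, Real.exp_add]
    refine ha.trans ?_
    push_cast
    rw [add_mul, Real.exp_add, one_mul, ← mul_assoc]
    exact mul_le_mul_of_nonneg_right hx (Real.exp_pos _).le

/-- A Chernoff bound in existence form: `s` samples, logarithmic in the number of test functions,
simultaneously bound the empirical means of all of them. -/
theorem exists_sample {A T : Type*} [Fintype A] [Fintype T] {p : A → ℝ}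
    (hp : p ∈ stdSimplex ℝ A) {g : T → A → ℝ} (hg : ∀ t a, |g t a| ≤ 1)
    (hg0 : ∀ t, ∑ a, p a * g t a = 0) {δ : ℝ} (hδ0 : 0 < δ) (hδ : δ ≤ 1) {s : ℕ}
    (hs : 4 * Real.log (Fintype.card T) ≤ s * δ ^ 2) :
    ∃ x : Fin s → A, ∀ t, ∑ q, g t (x q) ≤ s * δ := by
  -- `lam = δ / 2` balances the two terms `log |T| / lam` and `s * lam`.
  obtain ⟨x, hx⟩ := exists_exp_sample hp hg hg0 (half_pos hδ0).le (by linarith) s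
  refine ⟨x, fun t => ?_⟩
  have h1 : Real.exp (δ / 2 * ∑ q, g t (x q)) ≤ Fintype.card T * Real.exp (s * (δ / 2) ^ 2) :=
    (Finset.single_le_sum (f := fun t => Real.exp (δ / 2 * ∑ q, g t (x q)))
      (fun _ _ => (Real.exp_pos _).le) (Finset.mem_univ t)).trans hx
  have hT : (0 : ℝ) < Fintype.card T := by exact_mod_cast Fintype.card_pos_iff.2 ⟨t⟩
  rw [← Real.exp_log hT, ← Real.exp_add, Real.exp_le_exp] at h1
  have h2 : δ / 2 * ∑ q, g t (x q) ≤ δ / 2 * (s * δ) := by nlinarith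
  exact le_of_mul_le_mul_left h2 (half_pos hδ0)

/-- The uniform distribution on the multiset of samples `x`. -/
noncomputable def empirical {A : Type*} {s : ℕ} (x : Fin s → A) : A → ℝ :=
  open Classical in fun a => (∑ q, if x q = a then 1 else 0) / s

theorem sum_empirical_mul {A : Type*} [Fintype A] {s : ℕ} (x : Fin s → A) (g : A → ℝ) :
    ∑ a, empirical x a * g a = (∑ q, g (x q)) / s := by
  classical
  unfold empirical
  simp_rw [div_mul_eq_mul_div, Finset.sum_mul]
  rw [← Finset.sum_div, Finset.sum_comm]
  simp

theorem empirical_mem_stdSimplex {A : Type*} [Fintype A] {s : ℕ} (hs : 0 < s) (x : Fin s → A) :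
    empirical x ∈ stdSimplex ℝ A := by
  refine ⟨fun a => ?_, ?_⟩
  · unfold empirical
    positivity
  · have := sum_empirical_mul x fun _ => 1
    simp only [mul_one] at this
    rw [this]
    have : (s : ℝ) ≠ 0 := by exact_mod_cast hs.ne'
    simp [this]

/-- The players' mixed strategies can be replaced, one player after the other, by uniform
distributions on few samples, without increasing any of the test functions by much. -/
theorem exists_empirical {k : ℕ} {Act : Fin k → Type} [∀ i, Fintype (Act i)]
    {T : Type*} [Fintype T] {w : ∀ i, Act i → ℝ} (hw : ∀ i, w i ∈ stdSimplex ℝ (Act i))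
    {F : T → (∀ i, Act i) → ℝ} {B : ℝ} (hB : 0 < B) (hF : ∀ t a, |F t a| ≤ B)
    {δ : ℝ} (hδ0 : 0 < δ) (hδ : δ ≤ 1) {s : ℕ} (hs0 : 0 < s)
    (hs : 4 * Real.log (Fintype.card T) ≤ s * δ ^ 2) :
    ∃ x : ∀ i, Fin s → Act i, ∀ t,
      weightedSum (fun i => empirical (x i)) (F t) ≤ weightedSum w (F t) + k * (2 * B * δ) := by
  classical
  have hne : ∀ i, Nonempty (Act i) := fun i => by
    by_contra h
    rw [not_nonempty_iff] at h
    simpa using (hw i).2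
  suffices h : ∀ S : Finset (Fin k), ∃ x : ∀ i, Fin s → Act i, ∀ t,
      weightedSum (fun i => if i ∈ S then empirical (x i) else w i) (F t) ≤
        weightedSum w (F t) + S.card * (2 * B * δ) by
    simpa using h Finset.univ
  intro S
  induction S using Finset.induction_on with
  | empty => exact ⟨fun i _ => Classical.arbitrary _, by simp⟩
  | insert i S hi ih =>
    obtain ⟨x, hx⟩ := ih
    set v : ∀ i, Act i → ℝ := fun i => if i ∈ S then empirical (x i) else w i with hv
    have hvm : ∀ i, v i ∈ stdSimplex ℝ (Act i) := by
      intro i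
      simp only [hv]
      split_ifs
      · exact empirical_mem_stdSimplex hs0 _
      · exact hw i
    have hb : ∀ t b, |pureDeviation v (F t) i b - weightedSum v (F t)| ≤ 2 * B := by
      intro t b
      have h1 := pureDeviation_mem_Icc hvm (fun a => abs_le.1 (hF t a)) i b
      have h2 := weightedSum_mem_Icc hvm fun a => abs_le.1 (hF t a)
      rw [abs_le]
      constructor <;> linarith [h1.1, h1.2, h2.1, h2.2]
    have hB2 : 0 < 2 * B := by positivity
    obtain ⟨y, hy⟩ := exists_sample (hvm i)
      (g := fun t b => (pureDeviation v (F t) i b - weightedSum v (F t)) / (2 * B))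
      (fun t b => by rw [abs_div, abs_of_pos hB2]; exact div_le_one_of_le₀ (hb t b) hB2.le)
      (fun t => by
        simp_rw [← mul_div_assoc, mul_sub]
        rw [← Finset.sum_div, Finset.sum_sub_distrib, ← Finset.sum_mul, (hvm i).2,
          weightedSum_eq_sum_pureDeviation v _ i]
        simp)
      hδ0 hδ hs
    refine ⟨Function.update x i y, fun t => ?_⟩
    have he : (fun j => if j ∈ insert i S then empirical (Function.update x i y j) else w j)
        = Function.update v i (empirical y) := by
      funext j
      rcases eq_or_ne j i with rfl | hj
      · simp
      · simp [hj, hv]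
    have hs' : (0 : ℝ) < s := by exact_mod_cast hs0
    have h1 := hy t
    rw [← Finset.sum_div, div_le_iff₀ hB2, Finset.sum_sub_distrib, Finset.sum_const,
      Finset.card_univ, Fintype.card_fin, nsmul_eq_mul] at h1
    have h2 : (∑ q, pureDeviation v (F t) i (y q)) / s ≤
        weightedSum v (F t) + 2 * B * δ := by
      rw [div_le_iff₀ hs']
      linarith
    rw [he, weightedSum_update, sum_empirical_mul, Finset.card_insert_of_notMem hi]
    push_cast
    linarith [hx t]

/-- What player `i` gains in the profile `a` by switching to the action `b`. -/
def Game.regret {k : ℕ} (G : Game k) (ib : Σ i, G.Action i) (a : ∀ i, G.Action i) : ℝ :=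
  G.utility (Function.update a ib.1 ib.2) ib.1 - G.utility a ib.1

theorem Game.weightedSum_regret {k : ℕ} (G : Game k) {w : ∀ i, G.Action i → ℝ}
    (hw : ∀ i, w i ∈ stdSimplex ℝ (G.Action i)) (i : Fin k) (b : G.Action i) :
    weightedSum w (G.regret ⟨i, b⟩) =
      pureDeviation w (fun a => G.utility a i) i b - weightedSum w fun a => G.utility a i := by
  classical
  have h1 : weightedSum w (G.regret ⟨i, b⟩) =
      weightedSum w (fun a => G.utility (Function.update a i b) i)
        - weightedSum w fun a => G.utility a i := by
    simp only [weightedSum, Game.regret, mul_sub, Finset.sum_sub_distrib]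
  rw [h1, weightedSum_eq_sum_pureDeviation _ _ i]
  congr 1
  -- Player `i`'s own strategy does not matter once its action is overridden by `b`.
  have h2 : ∀ c, pureDeviation w (fun a => G.utility (Function.update a i b) i) i c =
      pureDeviation w (fun a => G.utility a i) i b := by
    intro c
    let φ : (∀ i, G.Action i) → ∀ i, G.Action i := fun a =>
      Function.update a i (Equiv.swap c b (a i))
    have hφ : Function.Involutive φ := fun a => by simp [φ]
    unfold pureDeviation weightedSum
    rw [← Equiv.sum_comp hφ.toPerm]
    refine Finset.sum_congr rfl fun a _ => ?_
    have hrest : ∏ j ∈ Finset.univ.erase i, w j (φ a j)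
        = ∏ j ∈ Finset.univ.erase i, w j (a j) :=
      Finset.prod_congr rfl fun j hj => by
        simp only [φ]
        rw [Function.update_of_ne (Finset.ne_of_mem_erase hj)]
    simp only [prod_update, Function.Involutive.coe_toPerm, hrest]
    by_cases ha : a i = b
    · have h3 : φ a i = c := by simp [φ, ha]
      have h4 : Function.update (φ a) i b = a := by simp [φ, ← ha]
      simp [h3, h4, ha]
    · have h3 : φ a i ≠ c := by
        simp only [φ, Function.update_self]
        rw [ne_eq, Equiv.swap_apply_eq_iff, Equiv.swap_apply_left]
        exact ha
      simp [h3, ha]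
  simp_rw [h2]
  rw [← Finset.sum_mul, (hw i).2, one_mul]

/-- The mixed strategy that draws one of the samples uniformly. -/
noncomputable def empiricalStrategy {A : Type*} [Fintype A] {s : ℕ} (hs : 0 < s)
    (x : Fin s → A) : stdSimplex ℝ A :=
  ⟨empirical x, empirical_mem_stdSimplex hs x⟩

/-- Every game has an `ε`-Nash equilibrium of uniform distributions on few samples. -/
theorem Game.exists_sparse_isEpsNash {k : ℕ} (G : Game k) {U ε Q : ℝ}
    (hU : ∀ a i, |G.utility a i| ≤ U) (hε : 0 < ε) (hQ : 1 ≤ Q) (hUQ : U ≤ Q * ε) {A : ℕ}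
    (hA : ∀ i, Fintype.card (G.Action i) ≤ A) {s : ℕ} (hs0 : 0 < s)
    (hs : 64 * ((k : ℝ) + 1) ^ 2 * Q ^ 2 * (k + Real.logb 2 A) ≤ s) :
    ∃ x : ∀ i, Fin s → G.Action i, G.IsEpsNash ε fun i => empiricalStrategy hs0 (x i) := by
  obtain ⟨σ, hσ⟩ := G.exists_isEpsNash
  rw [Game.isEpsNash_iff] at hσ
  have hQ0 : 0 < Q := by linarith
  have hreg : ∀ ib a, |G.regret ib a| ≤ 2 * (Q * ε) := by
    intro ib a
    have h1 := abs_le.1 (hU (Function.update a ib.1 ib.2) ib.1)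
    have h2 := abs_le.1 (hU a ib.1)
    unfold Game.regret
    rw [abs_le]
    constructor <;> linarith [h1.1, h1.2, h2.1, h2.2]
  have hlog : Real.log (Fintype.card (Σ i, G.Action i)) ≤ k + Real.logb 2 A := by
    have hlogA : Real.log A ≤ Real.logb 2 A := by
      have h2 : Real.log 2 ≤ 1 := by linarith [Real.log_two_lt_d9]
      exact le_div_self (Real.log_natCast_nonneg A) (Real.log_pos one_lt_two) h2
    have hA0 : 0 ≤ Real.log A := Real.log_natCast_nonneg A
    rcases Nat.eq_zero_or_pos (Fintype.card (Σ i, G.Action i)) with h0 | hpos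
    · rw [h0, Nat.cast_zero, Real.log_zero]
      exact add_nonneg (Nat.cast_nonneg k) (hA0.trans hlogA)
    · have hle : Fintype.card (Σ i, G.Action i) ≤ k * A := by
        rw [Fintype.card_sigma]
        simpa using Finset.sum_le_sum fun i (_ : i ∈ Finset.univ) => hA i
      have hkA : 0 < k * A := hpos.trans_le hle
      have hk : (0 : ℝ) < k := by exact_mod_cast Nat.pos_of_mul_pos_right hkA
      have hAp : (0 : ℝ) < A := by exact_mod_cast Nat.pos_of_mul_pos_left hkA
      calc Real.log (Fintype.card (Σ i, G.Action i)) ≤ Real.log (k * A) :=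
            Real.log_le_log (by exact_mod_cast hpos) (by exact_mod_cast hle)
        _ = Real.log k + Real.log A := Real.log_mul hk.ne' hAp.ne'
        _ ≤ _ := by linarith [Real.log_le_self hk.le]
  set δ : ℝ := 1 / (4 * (k + 1) * Q) with hδ
  have hk1 : (1 : ℝ) ≤ k + 1 := by linarith [Nat.cast_nonneg (α := ℝ) k]
  obtain ⟨x, hx⟩ := exists_empirical (fun i => (σ i).2) (F := G.regret)
    (B := 2 * (Q * ε)) (by positivity) hreg (δ := δ) (by positivity)
    (div_le_one_of_le₀ (by nlinarith) (by positivity)) hs0 (by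
      rw [hδ, div_pow, one_pow, mul_one_div, le_div_iff₀ (by positivity)]
      have := mul_le_mul_of_nonneg_left hlog
        (show 0 ≤ 64 * ((k : ℝ) + 1) ^ 2 * Q ^ 2 by positivity)
      nlinarith)
  refine ⟨x, (G.isEpsNash_iff _ _).2 fun i b => ?_⟩
  have h1 := hx ⟨i, b⟩
  rw [G.weightedSum_regret (fun i => (σ i).2),
    G.weightedSum_regret fun i => empirical_mem_stdSimplex hs0 (x i)] at h1
  have h2 : k * (2 * (2 * (Q * ε)) * δ) ≤ ε := by
    have : k * (2 * (2 * (Q * ε)) * δ) = ε * (k / (k + 1)) := by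
      rw [hδ]
      field_simp
      ring
    rw [this]
    exact mul_le_of_le_one_right hε.le (div_le_one_of_le₀ (by linarith) (by positivity))
  have h3 := hσ i b
  have h4 : (fun i => (empiricalStrategy hs0 (x i)).1) = fun i => empirical (x i) := rfl
  rw [h4]
  linarith

/-! ### Protocols from finite sets of certificates -/

theorem exists_protocol_of_certificates {k : ℕ} {X C : Type*} [Fintype C] [Nonempty C] {c : ℕ}
    (hC : Fintype.card C ≤ 2 ^ c) (accept : Fin k → X → C → Prop) {one zero : Set (Fin k → X)}
    (h1 : ∀ x ∈ one, ∃ p, ∀ i, accept i (x i) p)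
    (h0 : ∀ x ∈ zero, ∀ p, ¬ ∀ i, accept i (x i) p) :
    ∃ Q : NondetProtocol k X, Q.Verifies one zero c := by
  obtain ⟨e⟩ : Nonempty (C ↪ (Fin c → Bool)) :=
    Function.Embedding.nonempty_of_card_le (by simpa using hC)
  have hinj : Function.Injective fun p : C => List.ofFn (e p) :=
    List.ofFn_injective.comp e.injective
  refine ⟨⟨fun i x l => accept i x (Function.invFun (fun p : C => List.ofFn (e p)) l)⟩,
    fun x hx => ?_, fun x hx => ?_⟩
  · obtain ⟨p, hp⟩ := h1 x hx
    refine ⟨List.ofFn (e p), by simp, fun i => ?_⟩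
    simpa only [Function.leftInverse_invFun hinj p] using hp i
  · rintro ⟨l, -, hl⟩
    exact h0 x hx _ hl

section Values

variable {k m : ℕ}

theorem Valuation.val_nonneg (v : Valuation m) (S : Finset (Fin m)) : 0 ≤ v.val S := by
  rw [← v.val_empty]
  exact v.mono _ _ (Finset.empty_subset S)

theorem val_bundle_le_welfare (v : Fin k → Valuation m) (T : Allocation k m) (i : Fin k) :
    (v i).val (T.bundle i) ≤ welfare v T :=
  Finset.single_le_sum (f := fun i => (v i).val (T.bundle i))
    (fun i _ => (v i).val_nonneg _) (Finset.mem_univ i)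

theorem welfare_le_maxWelfare (v : Fin k → Valuation m) (T : Allocation k m) :
    welfare v T ≤ maxWelfare v :=
  le_ciSup (Set.finite_range _).bddAbove T

theorem exists_bundle_eq (i : Fin k) (S : Finset (Fin m)) :
    ∃ T : Allocation k m, T.bundle i = S := by
  classical
  exact ⟨fun j => if j ∈ S then some i else none, by ext j; simp [Allocation.bundle]⟩

/-- Values rounded up to multiples of `η` certify an upper bound on their sum up to `k η`. -/
theorem exists_rounding {η b : ℝ} (hη : 0 < η) {N : ℕ} (hN : b ≤ N * η) {e : ℝ} (h0 : 0 ≤ e)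
    (hb : e ≤ b) : ∃ n : Fin (N + 1), e ≤ n * η ∧ n * η ≤ e + η := by
  refine ⟨⟨⌈e / η⌉₊, Nat.lt_succ_of_le (Nat.ceil_le.2 ?_)⟩, ?_, ?_⟩
  · rw [div_le_iff₀ hη]
    linarith
  · exact (div_le_iff₀ hη).1 (Nat.le_ceil _)
  · have := (Nat.ceil_lt_add_one (div_nonneg h0 hη.le)).le
    have := mul_le_mul_of_nonneg_right this hη.le
    rwa [add_mul, div_mul_cancel₀ _ hη.ne', one_mul] at this

/-- For a fixed number of items there is some protocol: the rounded valuations themselves. -/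
theorem exists_trivial_protocol (k : ℕ) (V : Set (Valuation m)) {W α : ℝ} (hW : 0 < W)
    (hα : 1 < α) : ∃ (c : ℕ) (Q : NondetProtocol k V),
      Q.Verifies (oneInputs k V W α) (zeroInputs k V W) c := by
  have hgap : 0 < W - W / α := sub_pos.2 (div_lt_self hW hα)
  set η : ℝ := (W - W / α) / (k + 1) with hηdef
  have hη : 0 < η := by positivity
  have hkη : W / α + k * η < W := by
    have : (k + 1) * η = W - W / α := by rw [hηdef]; field_simp
    linarith
  set N : ℕ := ⌈W / α / η⌉₊
  have hN : W / α ≤ N * η := (div_le_iff₀ hη).1 (Nat.le_ceil _)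
  refine ⟨_, exists_protocol_of_certificates (C := Fin k → Finset (Fin m) → Fin (N + 1))
    (Nat.lt_two_pow_self).le
    (fun i v n => (∀ S, v.1.val S ≤ n i S * η) ∧
      ∀ T : Allocation k m, ∑ i, (n i (T.bundle i) : ℝ) * η < W) (fun x hx => ?_)
    fun x hx n hn => ?_⟩
  · have hle : ∀ i S, (x i).1.val S ≤ W / α := by
      intro i S
      obtain ⟨T, rfl⟩ := exists_bundle_eq i S
      exact (val_bundle_le_welfare (fun i => (x i).1) T i).trans (hx T)
    choose n hn1 hn2 using fun i S =>
      exists_rounding hη hN ((x i).1.val_nonneg S) (hle i S)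
    refine ⟨n, fun i => ⟨hn1 i, fun T => ?_⟩⟩
    calc ∑ i, (n i (T.bundle i) : ℝ) * η ≤ ∑ i, ((x i).1.val (T.bundle i) + η) :=
          Finset.sum_le_sum fun i _ => hn2 i _
      _ = welfare (fun i => (x i).1) T + k * η := by
          simp [welfare, Finset.sum_add_distrib]
      _ < W := by linarith [hx T]
  · obtain ⟨T, hT⟩ := hx
    have h1 : welfare (fun i => (x i).1) T ≤ ∑ i, (n i (T.bundle i) : ℝ) * η :=
      Finset.sum_le_sum fun i _ => (hn i).1 _
    rcases k.eq_zero_or_pos with rfl | hk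
    · simp [welfare] at hT
      linarith
    · linarith [(hn ⟨0, hk⟩).2 T]

/-! ### The protocol that guesses an equilibrium -/

/-- The expected value of player `i`, which depends on the valuation of that player only. -/
def Auction.expectedValue (M : Auction k m) (i : Fin k) (v : Valuation m)
    (σ : ∀ i, stdSimplex ℝ (M.Action i)) : ℝ :=
  mixedExpectation σ fun a => M.lotteryExpectation a fun T => v.val (T.bundle i)

theorem Auction.lotteryExpectation_mem_Icc (M : Auction k m) (a : ∀ i, M.Action i)
    {g : Allocation k m → ℝ} {l u : ℝ} (hg : ∀ T, g T ∈ Set.Icc l u) :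
    M.lotteryExpectation a g ∈ Set.Icc l u := by
  have h := (M.lottery a).2
  have h1 : ∀ c, ∑ T, (M.lottery a).1 T * c = c := fun c => by
    rw [← Finset.sum_mul, h.2, one_mul]
  constructor
  · rw [← h1 l]
    exact Finset.sum_le_sum fun T _ => mul_le_mul_of_nonneg_left (hg T).1 (h.1 T)
  · rw [← h1 u]
    exact Finset.sum_le_sum fun T _ => mul_le_mul_of_nonneg_left (hg T).2 (h.1 T)

theorem Auction.expectedWelfare_eq_sum (M : Auction k m) (v : Fin k → Valuation m)
    (σ : ∀ i, stdSimplex ℝ (M.Action i)) :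
    M.expectedWelfare v σ = ∑ i, M.expectedValue i (v i) σ := by
  unfold Auction.expectedWelfare Auction.expectedValue mixedExpectation
    Auction.lotteryExpectation welfare
  simp_rw [Finset.mul_sum]
  symm
  rw [Finset.sum_comm]
  refine Finset.sum_congr rfl fun a _ => ?_
  rw [Finset.sum_comm]

/-- An auction whose price of anarchy is at most `β < α` yields a protocol. The prover publishes a
sparse `ε`-Nash equilibrium, together with rounded-up expected values of the players; each
player checks that it cannot gain more than `ε` and that its own value is not underreported. -/
theorem Auction.exists_protocol (M : Auction k m) (V : Set (Valuation m))
    {W α β U ε Q : ℝ} (hW : 0 < W) (hβ : 0 < β) (hβα : β < α)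
    (hpoa : M.worstPOA V ε ≤ ENNReal.ofReal β)
    (hU : ∀ (v : Fin k → V) a i, |(M.game fun i => (v i : Valuation m)).utility a i| ≤ U)
    (hε : 0 < ε) (hQ : 1 ≤ Q) (hUQ : U ≤ Q * ε) {A l s N : ℕ}
    (hA : ∀ i, Fintype.card (M.Action i) ≤ A) (hl : A ≤ 2 ^ l) (hs0 : 0 < s)
    (hs : 64 * ((k : ℝ) + 1) ^ 2 * Q ^ 2 * (k + Real.logb 2 A) ≤ s)
    (hN : (k + 1) * β ≤ N * (α - β)) :
    ∃ Q : NondetProtocol k V,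
      Q.Verifies (oneInputs k V W α) (zeroInputs k V W) (k * (s * l + N)) := by
  have hα : 0 < α := hβ.trans hβα
  -- The precision `η` is chosen so that all rounding errors together stay below the gap
  -- `W / β - W / α` between the equilibrium welfares of `0`-inputs and of `1`-inputs.
  set η : ℝ := W * (α - β) / (α * β * (k + 1)) with hηdef
  have hαβ : 0 < α - β := sub_pos.2 hβα
  have hη : 0 < η := by positivity
  have hkη : W / α + k * η < W / β := by
    have : W / β = W / α + (k + 1) * η := by
      rw [hηdef]
      field_simp
      ring
    linarith
  have hNη : W / α ≤ N * η := by
    have : N * η = W / α * (N * (α - β) / ((k + 1) * β)) := by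
      rw [hηdef]
      field_simp
    rw [this]
    refine le_mul_of_one_le_right (by positivity) ?_
    rwa [one_le_div (by positivity)]
  have hcard : Fintype.card ((∀ i, Fin s → M.Action i) × (Fin k → Fin (N + 1))) ≤
      2 ^ (k * (s * l + N)) := by
    have h1 : ∀ i, Fintype.card (Fin s → M.Action i) ≤ 2 ^ (s * l) := by
      intro i
      rw [Fintype.card_fun, Fintype.card_fin, mul_comm, pow_mul]
      exact Nat.pow_le_pow_left ((hA i).trans hl) s
    have h2 : ∏ i, Fintype.card (Fin s → M.Action i) ≤ (2 ^ (s * l)) ^ k := by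
      simpa using Finset.prod_le_prod' fun i (_ : i ∈ Finset.univ) => h1 i
    have h3 : (N + 1) ^ k ≤ (2 ^ N) ^ k := Nat.pow_le_pow_left Nat.lt_two_pow_self k
    rw [Fintype.card_prod, Fintype.card_pi, Fintype.card_fun, Fintype.card_fin, Fintype.card_fin]
    refine (Nat.mul_le_mul h2 h3).trans_eq ?_
    rw [← mul_pow, ← pow_add, ← pow_mul, mul_comm]
  refine exists_protocol_of_certificates hcard
    (fun i v p =>
      (∀ τ : stdSimplex ℝ (M.Action i),
        mixedExpectation (Function.update (fun i => empiricalStrategy hs0 (p.1 i)) i τ)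
          (fun a => M.lotteryExpectation a (fun T => v.1.val (T.bundle i)) - M.payment a i) ≤
        mixedExpectation (fun i => empiricalStrategy hs0 (p.1 i))
          (fun a => M.lotteryExpectation a (fun T => v.1.val (T.bundle i)) - M.payment a i) + ε) ∧
      M.expectedValue i v.1 (fun i => empiricalStrategy hs0 (p.1 i)) ≤ p.2 i * η ∧
      ∑ j, (p.2 j : ℝ) * η < W / β) (fun x hx => ?_) fun x hx p hp => ?_
  · obtain ⟨y, hy⟩ := (M.game fun i => (x i).1).exists_sparse_isEpsNash (hU x) hε hQ hUQ hA hs0 hs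
    set σ : ∀ i, stdSimplex ℝ (M.Action i) := fun i => empiricalStrategy hs0 (y i) with hσ
    have hval : ∀ i, M.expectedValue i (x i).1 σ ∈ Set.Icc 0 (W / α) := fun i =>
      weightedSum_mem_Icc (fun i => (σ i).2) fun a => M.lotteryExpectation_mem_Icc a fun T =>
        ⟨(x i).1.val_nonneg _, (val_bundle_le_welfare (fun i => (x i).1) T i).trans (hx T)⟩
    have hwel : M.expectedWelfare (fun i => (x i).1) σ ≤ W / α :=
      (weightedSum_mem_Icc (l := 0) (fun i => (σ i).2) fun a =>
        M.lotteryExpectation_mem_Icc a fun T =>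
          ⟨Finset.sum_nonneg fun i _ => (x i).1.val_nonneg _, hx T⟩).2
    choose n hn1 hn2 using fun i => exists_rounding hη hNη (hval i).1 (hval i).2
    refine ⟨(y, n), fun i => ⟨fun τ => hy i τ, hn1 i, ?_⟩⟩
    calc ∑ i, (n i : ℝ) * η ≤ ∑ i, (M.expectedValue i (x i).1 σ + η) :=
          Finset.sum_le_sum fun i _ => hn2 i
      _ = M.expectedWelfare (fun i => (x i).1) σ + k * η := by
          rw [M.expectedWelfare_eq_sum]
          simp [Finset.sum_add_distrib]
      _ < W / β := by linarith
  · set σ : ∀ i, stdSimplex ℝ (M.Action i) := fun i => empiricalStrategy hs0 (p.1 i) with hσ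
    obtain ⟨T, hT⟩ := hx
    have hk : 0 < k := by
      rcases k.eq_zero_or_pos with rfl | hk
      · simp [welfare] at hT
        linarith
      · exact hk
    have hNash : (M.game fun i => (x i).1).IsEpsNash ε σ := fun i τ => (hp i).1 τ
    have hwel : M.expectedWelfare (fun i => (x i).1) σ < W / β := by
      rw [M.expectedWelfare_eq_sum]
      exact (Finset.sum_le_sum fun i _ => (hp i).2.1).trans_lt (hp ⟨0, hk⟩).2.2
    have hmax := hT.trans (welfare_le_maxWelfare (fun i => (x i).1) T)
    have hratio : ENNReal.ofReal (maxWelfare fun i => (x i).1) /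
        ENNReal.ofReal (M.expectedWelfare (fun i => (x i).1) σ) ≤ ENNReal.ofReal β :=
      (le_iSup₂_of_le x σ (le_iSup (fun _ : (M.game fun i => (x i).1).IsEpsNash ε σ => _)
        hNash)).trans hpoa
    rw [ENNReal.div_le_iff_le_mul (Or.inr ENNReal.ofReal_ne_top) (Or.inl ENNReal.ofReal_ne_top),
      ← ENNReal.ofReal_mul hβ.le, ENNReal.ofReal_le_ofReal_iff'] at hratio
    rw [lt_div_iff₀ hβ] at hwel
    rcases hratio with h | h <;> linarith

end Values

/-- The length of a certificate for `k` players, each with a list of samples from at most `A`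
actions and one rounded value. The numbers of samples and of rounded values are those that
`Auction.exists_protocol` needs for `β = ρ * α`, with `b = ρ / (1 - ρ)`. -/
theorem subexponential_cost {s : ExpScale} {k A : ℕ → ℕ}
    (hk : Subexponential s fun m => (k m : ℝ)) (hA : SubDoublyExponential s A)
    {Q : ℕ → ℝ} (hQ : Subexponential s Q) (hQ0 : ∀ m, 0 ≤ Q m) {b : ℝ} (hb : 0 ≤ b) :
    Subexponential s fun m => ((k m *
      ((⌈64 * ((k m : ℝ) + 1) ^ 2 * Q m ^ 2 * (k m + Real.logb 2 (A m))⌉₊ + 1) *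
        Nat.clog 2 (A m) + ⌈((k m : ℝ) + 1) * b⌉₊) : ℕ) : ℝ) := by
  have hceil : ∀ {f : ℕ → ℝ}, Subexponential s f → (∀ m, 0 ≤ f m) →
      Subexponential s fun m => (⌈f m⌉₊ : ℝ) := fun hf hf0 =>
    (hf.add (Subexponential.const s 1)).mono
      (Eventually.of_forall fun m => (Nat.ceil_lt_add_one (hf0 m)).le)
  have hA0 : ∀ m, 0 ≤ Real.logb 2 (A m) := fun m =>
    div_nonneg (Real.log_natCast_nonneg _) (Real.log_pos one_lt_two).le
  have hk1 := hk.add (Subexponential.const s 1)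
  have hN : Subexponential s fun m => (⌈((k m : ℝ) + 1) * b⌉₊ : ℝ) :=
    hceil (hk1.mul (Subexponential.const s _) (fun m => by positivity) fun m => by positivity)
      fun m => by positivity
  have hkk : Subexponential s fun m => 64 * ((k m : ℝ) + 1) ^ 2 := by
    simp only [sq]
    exact (Subexponential.const s 64).mul (hk1.mul hk1 (fun m => by positivity)
      fun m => by positivity) (fun m => by positivity) fun m => by positivity
  have hQQ : Subexponential s fun m => Q m ^ 2 := by
    simp only [sq]
    exact hQ.mul hQ hQ0 hQ0
  have hSum : Subexponential s fun m => k m + Real.logb 2 (A m) := hk.add hA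
  have hSum0 : ∀ m, 0 ≤ k m + Real.logb 2 (A m) := fun m => add_nonneg (Nat.cast_nonneg _) (hA0 m)
  have hS : Subexponential s fun m =>
      (⌈64 * ((k m : ℝ) + 1) ^ 2 * Q m ^ 2 * (k m + Real.logb 2 (A m))⌉₊ : ℝ) + 1 := by
    refine (hceil (((hkk.mul hQQ ?_ ?_).mul hSum ?_ hSum0)) fun m => ?_).add
      (Subexponential.const s 1)
    · intro m; positivity
    · intro m; positivity
    · intro m; positivity
    · exact mul_nonneg (by positivity) (hSum0 m)
  have hl : Subexponential s fun m => (Nat.clog 2 (A m) : ℝ) := by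
    refine (hceil hA hA0).mono (Eventually.of_forall fun m => ?_)
    exact_mod_cast (Real.natCeil_logb_natCast 2 (A m)).ge
  push_cast
  exact hk.mul ((hS.mul hl (fun m => by positivity) fun m => by positivity).add hN)
    (fun m => by positivity) fun m => by positivity

/-- If the price of anarchy stays below `ρ * α` with `ρ < 1`, there are cheap protocols. The limit
superior says nothing about finitely many `m`; there the trivial protocol is used. -/
theorem exists_subexponential_protocols {s : ExpScale} {k : ℕ → ℕ}
    (hk : Subexponential s fun m => (k m : ℝ)) (V : ∀ m : ℕ, Set (Valuation m))
    {W α : ℕ → ℝ} (hW : ∀ m, 0 < W m) (hα : ∀ m, 1 < α m) (M : ∀ m : ℕ, Auction (k m) m)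
    {A : ℕ → ℕ} (hA : SubDoublyExponential s A)
    (hMA : ∀ m i, Fintype.card ((M m).Action i) ≤ A m) {U ε : ℕ → ℝ}
    (hU : ∀ m (v : Fin (k m) → V m) a i,
      |((M m).game fun i => (v i : Valuation m)).utility a i| ≤ U m)
    (hε : ∀ m, 0 < ε m) {P : MvPolynomial (Fin 2) ℝ}
    (hP : ∀ m, U m ≤ MvPolynomial.eval ![(k m : ℝ), (m : ℝ)] P * ε m)
    (hlim : limsup (fun m => (M m).worstPOA (V m) (ε m) / ENNReal.ofReal (α m)) atTop < 1) :
    ∃ c : ℕ → ℕ, Subexponential s (fun m => (c m : ℝ)) ∧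
      ∀ m, ∃ Q : NondetProtocol (k m) (V m),
        Q.Verifies (oneInputs (k m) (V m) (W m) (α m)) (zeroInputs (k m) (V m) (W m)) (c m) := by
  classical
  obtain ⟨r, hr, hr1⟩ := exists_between hlim
  have hrtop : r ≠ ⊤ := (hr1.trans ENNReal.one_lt_top).ne
  obtain ⟨ρ, hρ0, rfl⟩ : ∃ ρ : ℝ, 0 < ρ ∧ ENNReal.ofReal ρ = r :=
    ⟨r.toReal, ENNReal.toReal_pos (bot_le.trans_lt hr).ne' hrtop, ENNReal.ofReal_toReal hrtop⟩
  have hρ1 : 0 < 1 - ρ := by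
    have := (ENNReal.ofReal_lt_one).1 hr1
    linarith
  have hα0 : ∀ m, 0 < α m := fun m => one_pos.trans (hα m)
  have hpoa : ∀ᶠ m in atTop, (M m).worstPOA (V m) (ε m) ≤ ENNReal.ofReal (ρ * α m) := by
    filter_upwards [eventually_lt_of_limsup_lt hr] with m hm
    rw [ENNReal.ofReal_mul hρ0.le]
    refine (ENNReal.div_le_iff_le_mul (Or.inl ?_) (Or.inl ENNReal.ofReal_ne_top)).1 hm.le
    simpa using hα0 m
  let Q : ℕ → ℝ := fun m => |MvPolynomial.eval ![(k m : ℝ), (m : ℝ)] P| + 1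
  let S : ℕ → ℕ := fun m =>
    ⌈64 * ((k m : ℝ) + 1) ^ 2 * Q m ^ 2 * (k m + Real.logb 2 (A m))⌉₊ + 1
  let N : ℕ → ℕ := fun m => ⌈((k m : ℝ) + 1) * (ρ / (1 - ρ))⌉₊
  have hlarge : ∀ᶠ m in atTop, ∃ R : NondetProtocol (k m) (V m),
      R.Verifies (oneInputs (k m) (V m) (W m) (α m)) (zeroInputs (k m) (V m) (W m))
        (k m * (S m * Nat.clog 2 (A m) + N m)) := by
    filter_upwards [hpoa] with m hm
    refine (M m).exists_protocol (V m) (hW m) (mul_pos hρ0 (hα0 m)) (by nlinarith [hα0 m]) hm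
      (hU m) (hε m) (Q := Q m) (by simp [Q]) ((hP m).trans ?_) (hMA m)
      (Nat.le_pow_clog one_lt_two _) (Nat.succ_pos _) ?_ ?_
    · exact mul_le_mul_of_nonneg_right ((le_abs_self _).trans (le_add_of_nonneg_right zero_le_one))
        (hε m).le
    · simp only [S]
      push_cast
      exact (Nat.le_ceil _).trans (by linarith)
    · have := Nat.le_ceil (((k m : ℝ) + 1) * (ρ / (1 - ρ)))
      have := mul_le_mul_of_nonneg_right this (mul_pos hρ1 (hα0 m)).le
      have h : ((k m : ℝ) + 1) * (ρ / (1 - ρ)) * ((1 - ρ) * α m) = (k m + 1) * (ρ * α m) := by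
        field_simp
      simp only [N]
      linarith
  have hQ : Subexponential s Q := (hk.abs_eval P).add (Subexponential.const s 1)
  have hsub := subexponential_cost hk hA hQ (fun m => by positivity)
    (div_pos hρ0 hρ1).le
  choose c₀ hc₀ using fun m => exists_trivial_protocol (k m) (V m) (hW m) (hα m)
  refine ⟨fun m => if ∃ R : NondetProtocol (k m) (V m),
      R.Verifies (oneInputs (k m) (V m) (W m) (α m)) (zeroInputs (k m) (V m) (W m))
        (k m * (S m * Nat.clog 2 (A m) + N m)) then k m * (S m * Nat.clog 2 (A m) + N m)
      else c₀ m, hsub.mono ?_, fun m => ?_⟩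
  · filter_upwards [hlarge] with m hm
    rw [if_pos hm]
  · beta_reduce
    split_ifs with h
    · exact h
    · exact hc₀ m

end AuctionPOA

theorem theorem7p8
    (s : AuctionPOA.ExpScale)
    -- number of players and class of valuations, for each number `m` of items
    (k : ℕ → ℕ) (hk : AuctionPOA.Subexponential s fun m => (k m : ℝ))
    (V : ∀ m : ℕ, Set (AuctionPOA.Valuation m))
    -- the thresholds of the promise problem
    (W α : ℕ → ℝ) (hW : ∀ m, 0 < W m) (hα : ∀ m, 1 < α m)
    -- there is no nondeterministic protocol with subexponential communication
    (hcc : ¬ ∃ c : ℕ → ℕ, AuctionPOA.Subexponential s (fun m => (c m : ℝ)) ∧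
      ∀ m, ∃ Q : AuctionPOA.NondetProtocol (k m) (V m),
        Q.Verifies (AuctionPOA.oneInputs (k m) (V m) (W m) (α m))
          (AuctionPOA.zeroInputs (k m) (V m) (W m)) (c m))
    -- an auction for each `m`, with a sub-doubly-exponential number of actions per player
    (M : ∀ m : ℕ, AuctionPOA.Auction (k m) m)
    (A : ℕ → ℕ) (hA : AuctionPOA.SubDoublyExponential s A)
    (hMA : ∀ m i, Fintype.card ((M m).Action i) ≤ A m)
    -- utilities are in `[-U, U]`, and `ε`, relative to `U`, is at least an inverse polynomial
    (U ε : ℕ → ℝ)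
    (hU : ∀ m (v : Fin (k m) → V m) a i,
      |((M m).game fun i => (v i : AuctionPOA.Valuation m)).utility a i| ≤ U m)
    (hε : ∀ m, 0 < ε m)
    (P : MvPolynomial (Fin 2) ℝ)
    (hP : ∀ m, U m ≤ MvPolynomial.eval ![(k m : ℝ), (m : ℝ)] P * ε m) :
    1 ≤ Filter.limsup
      (fun m => (M m).worstPOA (V m) (ε m) / ENNReal.ofReal (α m)) Filter.atTop := by
  by_contra! hlim
  exact hcc (AuctionPOA.exists_subexponential_protocols hk V hW hα M hA hMA hU hε hP hlim)
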